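/- Let $p\in(1,\infty)$. Let $V_0=\{q_1,q_2,q_3\}\subset\mathbb{R}^2$ be the set of vertices of an equilateral triangle, let $f_i(x)=q_i+\tfrac12(x-q_i)$ for $i\in\{1,2,3\}$, let $K$ (the Sierpiński gasket) be the unique non-empty compact set with $K=\bigcup_{i=1}^3 f_i(K)$, let $V_1=\bigcup_{i=1}^3 f_i(V_0)\supset V_0$, and let $\mathcal{G}_{\mathrm{sym}}$ be the group of isometries of $K$ with respect to the Euclidean metric. A $p$-resistance form on a non-empty set $X$ is a pair $(\mathcal{E},\mathcal{F})$ of a linear subspace $\mathcal{F}\subset\mathbb{R}^X$ and a functional $\mathcal{E}\colon\mathcal{F}\to[0,\infty)$ such that: (RF1) $\mathcal{E}^{1/p}$ is a seminorm on $\mathcal{F}$, and $\{u\in\mathcal{F}\mid\mathcal{E}(u)=0\}$ is the set of constant functions on $X$; (RF2) the quotient normed space of $(\mathcal{F},\mathcal{E}^{1/p})$ by the constant functions is complete; (RF3) for any $x\neq y$ in $X$ there is $u\in\mathcal{F}$ with $u(x)\neq u(y)$; (RF4) $\sup\{|u(x)-u(y)|^p/\mathcal{E}(u)\mid u\in\mathcal{F}\text{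 non-constant}\}<\infty$ for any $x,y\in X$; (RF5) (generalized contraction property) if $q\in(0,p]$, $r\in[p,\infty]$, $m,n\geq1$ are integers, and $T=(T_1,\dots,T_n)\colon\mathbb{R}^m\to\mathbb{R}^n$ satisfies $T(0)=0$ and $\|T(x)-T(y)\|_{\ell^r}\leq\|x-y\|_{\ell^q}$ for all $x,y\in\mathbb{R}^m$, then for all $u=(u_1,\dots,u_m)\in\mathcal{F}^m$ one has $T_k(u)\in\mathcal{F}$ for every $k$ and $$\bigl\|(\mathcal{E}(T_k(u))^{1/p})_{k=1}^n\bigr\|_{\ell^r}\leq\bigl\|(\mathcal{E}(u_j)^{1/p})_{j=1}^m\bigr\|_{\ell^q}.$$ If $X$ is finite, necessarily $\mathcal{F}=\mathbb{R}^X$, and one calls $\mathcal{E}\colon\mathbb{R}^X\to[0,\infty)$ itself a $p$-resistance form on $X$. For $\rho\in(0,\infty)$ and a $p$-resistance form $E$ on $V_0$, define $\mathcal{R}_{\rho,1}(E)$ on $\mathbb{R}^{V_1}$ and its trace $\mathcal{R}_{\rho,1}(E)|_{V_0}$ on $\mathbb{R}^{V_0}$ by $$\mathcal{R}_{\rho,1}(E)(v)=\sum_{i=1}^3\rho\,E(v\circ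 f_i|_{V_0}),\qquad \mathcal{R}_{\rho,1}(E)|_{V_0}(u)=\inf\{\mathcal{R}_{\rho,1}(E)(v)\mid v\in\mathbb{R}^{V_1},\ v|_{V_0}=u\}.$$ **Theorem.** There exists a unique $\rho_p\in(0,\infty)$ such that $\mathcal{R}_{\rho_p,1}(E^{(0)})|_{V_0}=E^{(0)}$ for some $p$-resistance form $E^{(0)}$ on $V_0$. Moreover, for this $\rho_p$, $E^{(0)}$ can be chosen to be $\mathcal{G}_{\mathrm{sym}}$-invariant: every $g\in\mathcal{G}_{\mathrm{sym}}$ satisfies $g(V_0)\subset V_0$, and $E^{(0)}(u\circ g|_{V_0})=E^{(0)}(u)$ for all $u\in\mathbb{R}^{V_0}$ and all $g\in\mathcal{G}_{\mathrm{sym}}$. -/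

import Mathlib

open scoped ENNReal NNReal

noncomputable section

/-! ### The Sierpinski gasket -/

/-- The Euclidean plane. -/
abbrev Plane : Type := EuclideanSpace ℝ (Fin 2)

/-- `q` lists the three vertices of a (nondegenerate) equilateral triangle in the plane. -/
def IsEquilateralTriangle (q : Fin 3 → Plane) : Prop :=
  ∃ ℓ : ℝ, 0 < ℓ ∧ ∀ i j : Fin 3, i ≠ j → dist (q i) (q j) = ℓ

/-- The contraction `f_i(x) = q_i + (x - q_i) / 2` of the plane. -/
def sgMap (q : Fin 3 → Plane) (i : Fin 3) (x : Plane) : Plane :=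
  q i + (1 / 2 : ℝ) • (x - q i)

/-- `V₀ = {q_1, q_2, q_3}`. -/
def sgV0 (q : Fin 3 → Plane) : Set Plane := Set.range q

/-- `V₁ = f_1(V₀) ∪ f_2(V₀) ∪ f_3(V₀)`. -/
def sgV1 (q : Fin 3 → Plane) : Set Plane := ⋃ i, sgMap q i '' sgV0 q

theorem sgV0_subset_sgV1 (q : Fin 3 → Plane) : sgV0 q ⊆ sgV1 q := by
  rintro _ ⟨i, rfl⟩
  exact Set.mem_iUnion.2 ⟨i, q i, ⟨i, rfl⟩, by simp [sgMap]⟩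

theorem sgMap_mem_sgV1 (q : Fin 3 → Plane) (i : Fin 3) {x : Plane} (hx : x ∈ sgV0 q) :
    sgMap q i x ∈ sgV1 q :=
  Set.mem_iUnion.2 ⟨i, x, hx, rfl⟩

/-- `K` is a non-empty compact set with `K = f_1(K) ∪ f_2(K) ∪ f_3(K)`. -/
def IsSelfSimilar (q : Fin 3 → Plane) (K : Set Plane) : Prop :=
  K.Nonempty ∧ IsCompact K ∧ K = ⋃ i, sgMap q i '' K

theorem edist_sgMap (q : Fin 3 → Plane) (i : Fin 3) (x y : Plane) :
    edist (sgMap q i x) (sgMap q i y) = ((1 / 2 : ℝ≥0) : ℝ≥0∞) * edist x y := by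
  have h : dist (sgMap q i x) (sgMap q i y) = (1 / 2 : ℝ) * dist x y := by
    simp [sgMap, dist_smul₀]
  rw [edist_dist, edist_dist, h, ENNReal.ofReal_mul (by norm_num)]
  congr 1
  rw [ENNReal.ofReal]
  congr 1
  ext
  simp

theorem continuous_sgMap (q : Fin 3 → Plane) (i : Fin 3) : Continuous (sgMap q i) := by
  unfold sgMap
  fun_prop

/-- The self-similar set associated with `f_1, f_2, f_3` exists and is unique. -/
theorem existsUnique_isSelfSimilar (q : Fin 3 → Plane) : ∃! K : Set Plane, IsSelfSimilar q K := by
  let Φ : TopologicalSpace.NonemptyCompacts Plane → TopologicalSpace.NonemptyCompacts Plane :=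
    fun A => ⟨⟨⋃ i, sgMap q i '' (A : Set Plane),
      isCompact_iUnion fun i => A.isCompact.image (continuous_sgMap q i)⟩,
      Set.nonempty_iUnion.2 ⟨0, A.nonempty.image _⟩⟩
  have key : ∀ A B : TopologicalSpace.NonemptyCompacts Plane,
      ∀ x ∈ ⋃ i, sgMap q i '' (A : Set Plane), ∃ y ∈ ⋃ i, sgMap q i '' (B : Set Plane),
        edist x y ≤ ((1 / 2 : ℝ≥0) : ℝ≥0∞) *
          Metric.hausdorffEDist (A : Set Plane) (B : Set Plane) := by
    intro A B x hx
    obtain ⟨i, a, ha, rfl⟩ := Set.mem_iUnion.1 hx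
    obtain ⟨b, hb, hab⟩ := B.isCompact.exists_infEDist_eq_edist B.nonempty a
    refine ⟨sgMap q i b, Set.mem_iUnion.2 ⟨i, b, hb, rfl⟩, ?_⟩
    rw [edist_sgMap, ← hab]
    gcongr
    exact Metric.infEDist_le_hausdorffEDist_of_mem ha
  have hΦ : ContractingWith (1 / 2 : ℝ≥0) Φ := by
    refine ⟨by rw [← NNReal.coe_lt_coe]; norm_num, fun A B => ?_⟩
    refine Metric.hausdorffEDist_le_of_mem_edist (key A B) fun x hx => ?_
    rw [show edist A B = Metric.hausdorffEDist (B : Set Plane) (A : Set Plane) from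
      Metric.hausdorffEDist_comm]
    exact key B A x hx
  have : Nonempty (TopologicalSpace.NonemptyCompacts Plane) := ⟨{0}⟩
  let A₀ : TopologicalSpace.NonemptyCompacts Plane := ContractingWith.fixedPoint Φ hΦ
  refine ⟨(A₀ : Set Plane), ⟨A₀.nonempty, A₀.isCompact, ?_⟩, ?_⟩
  · exact (congrArg (fun A : TopologicalSpace.NonemptyCompacts Plane => (A : Set Plane))
      hΦ.fixedPoint_isFixedPt).symm
  · rintro K ⟨hne, hc, hK⟩
    have hfix : Function.IsFixedPt Φ ⟨⟨K, hc⟩, hne⟩ :=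
      TopologicalSpace.NonemptyCompacts.ext hK.symm
    exact congrArg (fun A : TopologicalSpace.NonemptyCompacts Plane => (A : Set Plane))
      (hΦ.fixedPoint_unique hfix)

/-- The Sierpinski gasket with outer vertices `q_1, q_2, q_3`: the unique non-empty compact set
`K` with `K = f_1(K) ∪ f_2(K) ∪ f_3(K)`. -/
def sierpinskiGasket (q : Fin 3 → Plane) : Set Plane :=
  (existsUnique_isSelfSimilar q).choose

theorem isSelfSimilar_sierpinskiGasket (q : Fin 3 → Plane) :
    IsSelfSimilar q (sierpinskiGasket q) :=
  (existsUnique_isSelfSimilar q).choose_spec.1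

/-- `V₀ ⊆ K`: a point `z` of `K` is moved to the vertex `q_i` by iterating `f_i`. -/
theorem sgV0_subset_sierpinskiGasket (q : Fin 3 → Plane) : sgV0 q ⊆ sierpinskiGasket q := by
  rintro _ ⟨i, rfl⟩
  obtain ⟨⟨z, hz⟩, hc, hK⟩ := isSelfSimilar_sierpinskiGasket q
  have hmem : ∀ n : ℕ, q i + ((1 / 2 : ℝ) ^ n) • (z - q i) ∈ sierpinskiGasket q := by
    intro n
    induction n with
    | zero => simpa using hz
    | succ n ih =>
      rw [hK]
      refine Set.mem_iUnion.2 ⟨i, _, ih, ?_⟩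
      simp only [sgMap, add_sub_cancel_left, smul_smul, pow_succ']
  have hlim : Filter.Tendsto (fun n : ℕ => q i + ((1 / 2 : ℝ) ^ n) • (z - q i)) Filter.atTop
      (nhds (q i + (0 : ℝ) • (z - q i))) :=
    ((tendsto_pow_atTop_nhds_zero_of_lt_one (by norm_num) (by norm_num)).smul_const _).const_add _
  simpa using hc.isClosed.mem_of_tendsto hlim (Filter.Eventually.of_forall hmem)

/-! ### `p`-resistance forms -/

/-- The norm `‖x‖_{ℓ^r}` on `ℝ^n` for `r ∈ (0, ∞]` (a quasi-norm if `r < 1`). -/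
def ellNorm {n : ℕ} (r : ℝ≥0∞) (x : Fin n → ℝ) : ℝ :=
  ‖(WithLp.toLp r x : PiLp r fun _ : Fin n => ℝ)‖

/-- `(E, F)` is a `p`-resistance form on the set `X`: `F` is a linear subspace of `ℝ^X` and `E` is
a functional `F → [0, ∞)`, given here by a function on `ℝ^X` of which only the values on `F` are
used. -/
structure IsPResistanceForm (p : ℝ) {X : Type*} (F : Submodule ℝ (X → ℝ)) (E : (X → ℝ) → ℝ) :
    Prop where
  nonneg : ∀ u ∈ F, 0 ≤ E u
  /-- `E^{1/p}` is a seminorm on `F`. -/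
  rf1_seminorm : ∃ N : Seminorm ℝ F, ∀ u : F, N u = E u ^ (1 / p)
  /-- The functions of energy zero are exactly the constant functions. -/
  rf1_ker : ∀ u : X → ℝ, (u ∈ F ∧ E u = 0) ↔ ∃ c : ℝ, u = fun _ => c
  /-- The normed space `(F / constants, E^{1/p})` is complete. -/
  rf2 : ∀ u : ℕ → X → ℝ, (∀ n, u n ∈ F) →
    (∀ ε : ℝ, 0 < ε → ∃ N : ℕ, ∀ m n : ℕ, N ≤ m → N ≤ n → E (u m - u n) ^ (1 / p) < ε) →
    ∃ v ∈ F, Filter.Tendsto (fun n => E (u n - v) ^ (1 / p)) Filter.atTop (nhds 0)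
  /-- `F` separates points. -/
  rf3 : ∀ x y : X, x ≠ y → ∃ u ∈ F, u x ≠ u y
  /-- The `p`-resistance between any two points is finite. -/
  rf4 : ∀ x y : X,
    BddAbove {t : ℝ | ∃ u ∈ F, (¬ ∃ c : ℝ, u = fun _ => c) ∧ t = |u x - u y| ^ p / E u}
  /-- The generalized contraction property. -/
  rf5 : ∀ q r : ℝ≥0∞, 0 < q → q ≤ ENNReal.ofReal p → ENNReal.ofReal p ≤ r →
    ∀ m n : ℕ, 0 < m → 0 < n → ∀ T : (Fin m → ℝ) → (Fin n → ℝ),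
    (∀ x y : Fin m → ℝ, ellNorm r (T x - T y) ≤ ellNorm q (x - y)) → T 0 = 0 →
    ∀ u : Fin m → X → ℝ, (∀ j, u j ∈ F) →
      (∀ k : Fin n, (fun x => T (fun j => u j x) k) ∈ F) ∧
      ellNorm r (fun k : Fin n => E (fun x => T (fun j => u j x) k) ^ (1 / p)) ≤
        ellNorm q (fun j : Fin m => E (u j) ^ (1 / p))

/-- A `p`-resistance form on a finite set `X`: its domain is all of `ℝ^X`. -/
def IsFinitePResistanceForm (p : ℝ) {X : Type*} (E : (X → ℝ) → ℝ) : Prop :=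
  IsPResistanceForm p (⊤ : Submodule ℝ (X → ℝ)) E

/-- The trace to `A` of a form `E` on `B ⊇ A` with domain `ℝ^B`:
`E|_A(u) = inf {E(v) | v ∈ ℝ^B, v|_A = u}`. -/
def formTrace {Y : Type*} {A B : Set Y} (hAB : A ⊆ B) (E : (B → ℝ) → ℝ) : (A → ℝ) → ℝ :=
  fun u => sInf {t : ℝ | ∃ v : B → ℝ, v ∘ Set.inclusion hAB = u ∧ t = E v}

/-! ### The renormalization operator on the gasket -/

/-- `R_{ρ,1}(E)(u) = ∑_i ρ E(u ∘ f_i|_{V₀})` for `u ∈ ℝ^{V₁}`. -/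
def sgRenorm (q : Fin 3 → Plane) (ρ : ℝ) (E : (sgV0 q → ℝ) → ℝ) : (sgV1 q → ℝ) → ℝ :=
  fun u => ∑ i : Fin 3, ρ * E (fun x => u ⟨sgMap q i x, sgMap_mem_sgV1 q i x.2⟩)

/-- `E` is a `p`-resistance form on `V₀` with `R_{ρ,1}(E)|_{V₀} = E`. -/
def IsSGEigenform (p : ℝ) (q : Fin 3 → Plane) (ρ : ℝ) (E : (sgV0 q → ℝ) → ℝ) : Prop :=
  IsFinitePResistanceForm p E ∧ formTrace (sgV0_subset_sgV1 q) (sgRenorm q ρ E) = E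

/-- `E` is invariant under every isometry `g` of the gasket `K` (with the Euclidean metric) onto
itself: `g` maps `V₀` into `V₀`, and `E(u ∘ g|_{V₀}) = E(u)` for every `u ∈ ℝ^{V₀}`. -/
def IsSGSymmetric (q : Fin 3 → Plane) (E : (sgV0 q → ℝ) → ℝ) : Prop :=
  ∀ g : sierpinskiGasket q ≃ᵢ sierpinskiGasket q,
    ∃ hg : ∀ x : sgV0 q, (g ⟨x, sgV0_subset_sierpinskiGasket q x.2⟩ : Plane) ∈ sgV0 q,
      ∀ u : sgV0 q → ℝ, E (fun x => u ⟨_, hg x⟩) = E u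

end

/-!
A function on `V₁` is a symmetric matrix `w`, where `w i j` is the value at `f_i(q_j) = f_j(q_i)`.
In these terms the operator `E ↦ R_{1,1}(E)|_{V₀}` on forms on three points is `renormTrace`,
written `Λ` below. It is monotone and positively homogeneous, hence two comparable eigenforms have
the same eigenvalue (`eigenvalue_le_of_le_mul`); since any two `p`-resistance forms on three points
are comparable, `ρ` is unique.

For existence, the class of forms on three points that have the generalized contraction property is
closed under sums (by Minkowski's inequality for the exponent `r / p ≥ 1` and its reverse for `q / p
≤ 1`), under pointwise limits and under `Λ`. The contraction property also bounds a form that is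
invariant under permutations, from above and below, by its conductance (the energy of the indicator
function of a point) times the `p`-energy `E₀` of the triangle graph (`IsSymmForm.le_refEnergy`,
`IsSymmForm.refEnergy_le`). Therefore the conductances of `Λⁿ(E₀)` form a quasi-multiplicative
sequence, and `Λⁿ(E₀)` is comparable to `cⁿ E₀` for some `c > 0`, uniformly in `n`
(`exists_iterate_refEnergy_bounds`). As `Λ` is superadditive, the Cesàro means of `c⁻ⁿ Λⁿ(E₀)`
accumulate at a form `A` with `Λ(A) ≥ c A` (`exists_isSymmForm_mul_le_renormTrace`). The sequence
`c⁻ⁿ Λⁿ(A)` is then increasing and bounded, and its limit `G` satisfies `Λ(G) = c G`, because almost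
minimizing extensions stay in a compact set (`renormTrace_le_of_monotone`, `exists_eigenform`). So
`ρ = c⁻¹`.

The form `G` is invariant under permutations of the vertices. An isometry of the gasket permutes the
vertices, since they are the only points of the gasket at which its diameter is attained
(`mem_sgV0_of_dist_eq`).
-/

noncomputable section

/-! ### The generalized contraction property -/

section EllNorm

variable {n : ℕ}

theorem ellNorm_top (x : Fin n → ℝ) : ellNorm ⊤ x = ⨆ k, |x k| := by
  simp [ellNorm, PiLp.norm_eq_ciSup]

theorem ellNorm_of_toReal_pos {r : ℝ≥0∞} (hr : 0 < r.toReal) (x : Fin n → ℝ) :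
    ellNorm r x = (∑ k, |x k| ^ r.toReal) ^ (1 / r.toReal) := by
  simp [ellNorm, PiLp.norm_eq_sum hr]

theorem ellNorm_nonneg {r : ℝ≥0∞} (hr : 0 < r) (x : Fin n → ℝ) : 0 ≤ ellNorm r x := by
  rcases eq_or_ne r ⊤ with rfl | h
  · rw [ellNorm_top]
    exact Real.iSup_nonneg fun _ => abs_nonneg _
  · rw [ellNorm_of_toReal_pos (ENNReal.toReal_pos hr.ne' h)]
    positivity

theorem abs_le_ellNorm_top (x : Fin n → ℝ) (k : Fin n) : |x k| ≤ ellNorm ⊤ x := by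
  rw [ellNorm_top]
  exact le_ciSup (f := fun k => |x k|) (Set.finite_range _).bddAbove k

theorem ellNorm_mono {r : ℝ≥0∞} (hr : 0 < r) {x y : Fin n → ℝ} (h : ∀ k, |x k| ≤ |y k|) :
    ellNorm r x ≤ ellNorm r y := by
  rcases eq_or_ne r ⊤ with rfl | hr'
  · rw [ellNorm_top x]
    exact Real.iSup_le (fun k => (h k).trans (abs_le_ellNorm_top y k)) (ellNorm_nonneg hr y)
  · have := ENNReal.toReal_pos hr.ne' hr'
    rw [ellNorm_of_toReal_pos this, ellNorm_of_toReal_pos this]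
    exact Real.rpow_le_rpow (by positivity)
      (Finset.sum_le_sum fun k _ => Real.rpow_le_rpow (abs_nonneg _) (h k) this.le) (by positivity)

theorem continuous_ellNorm {r : ℝ≥0∞} (hr : 0 < r) :
    Continuous (ellNorm r : (Fin n → ℝ) → ℝ) := by
  rcases eq_or_ne r ⊤ with rfl | hr'
  · have : (ellNorm ⊤ : (Fin n → ℝ) → ℝ) = fun x => ‖x‖ := by
      ext x
      exact PiLp.norm_toLp x
    rw [this]
    exact continuous_norm
  · have h := ENNReal.toReal_pos hr.ne' hr'
    rw [show (ellNorm r : (Fin n → ℝ) → ℝ) = _ from funext (ellNorm_of_toReal_pos h)]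
    refine Continuous.rpow_const (continuous_finsetSum _ fun k _ => ?_)
      fun _ => Or.inr (by positivity)
    exact Continuous.rpow_const (by fun_prop) fun _ => Or.inr h.le

theorem ellNorm_smul {r : ℝ≥0∞} (hr : 0 < r) {c : ℝ} (hc : 0 ≤ c) (x : Fin n → ℝ) :
    ellNorm r (fun k => c * x k) = c * ellNorm r x := by
  rcases eq_or_ne r ⊤ with rfl | hr'
  · simp only [ellNorm_top, abs_mul, abs_of_nonneg hc]
    exact (Real.mul_iSup_of_nonneg hc _).symm
  · have h := ENNReal.toReal_pos hr.ne' hr'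
    simp only [ellNorm_of_toReal_pos h, abs_mul, abs_of_nonneg hc]
    simp only [Real.mul_rpow hc (abs_nonneg _)]
    rw [← Finset.mul_sum, Real.mul_rpow (by positivity) (by positivity), one_div,
      Real.rpow_rpow_inv hc h.ne']

theorem ellNorm_fin_one {r : ℝ≥0∞} (hr : 0 < r) (x : Fin 1 → ℝ) : ellNorm r x = |x 0| := by
  rcases eq_or_ne r ⊤ with rfl | hr'
  · simp [ellNorm_top]
  · have h := ENNReal.toReal_pos hr.ne' hr'
    simp [ellNorm_of_toReal_pos h, Real.rpow_rpow_inv (abs_nonneg _) h.ne']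

theorem ellNorm_one_fin_two (x : Fin 2 → ℝ) : ellNorm 1 x = |x 0| + |x 1| := by
  rw [ellNorm_of_toReal_pos (by simp)]
  simp

/-- In terms of `A = x ^ p`, the `p`-th power of the `ℓ^r` norm of `x` is the `ℓ^{r/p}` norm of
`A`. -/
theorem ellNorm_rpow {p : ℝ} (hp : 0 < p) {r : ℝ≥0∞} (hr : 0 < r.toReal) {A : Fin n → ℝ}
    (hA : ∀ k, 0 ≤ A k) :
    ellNorm r (fun k => A k ^ (1 / p)) ^ p
      = (∑ k, A k ^ (r.toReal / p)) ^ (1 / (r.toReal / p)) := by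
  rw [ellNorm_of_toReal_pos hr, ← Real.rpow_mul (by positivity)]
  congr 1
  · refine Finset.sum_congr rfl fun k _ => ?_
    rw [abs_of_nonneg (Real.rpow_nonneg (hA k) _), ← Real.rpow_mul (hA k)]
    congr 1
    field_simp
  · field_simp

/-- Minkowski's inequality in `ℓ^{r/p}`, where `r / p ≥ 1`. -/
theorem ellNorm_rpow_add_le {p : ℝ} (hp : 0 < p) {r : ℝ≥0∞} (hr : ENNReal.ofReal p ≤ r)
    {A B : Fin n → ℝ} (hA : ∀ k, 0 ≤ A k) (hB : ∀ k, 0 ≤ B k) :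
    ellNorm r (fun k => (A k + B k) ^ (1 / p)) ^ p ≤
      ellNorm r (fun k => A k ^ (1 / p)) ^ p + ellNorm r (fun k => B k ^ (1 / p)) ^ p := by
  have hr0 : 0 < r := (ENNReal.ofReal_pos.2 hp).trans_le hr
  rcases eq_or_ne r ⊤ with rfl | hr'
  · have key : ∀ C : Fin n → ℝ, (∀ k, 0 ≤ C k) → ∀ k,
        C k ≤ ellNorm ⊤ (fun k => C k ^ (1 / p)) ^ p := by
      intro C hC k
      have h1 := abs_le_ellNorm_top (fun k => C k ^ (1 / p)) k
      rw [abs_of_nonneg (Real.rpow_nonneg (hC k) _), one_div] at h1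
      simpa [Real.rpow_inv_rpow (hC k) hp.ne'] using
        Real.rpow_le_rpow (Real.rpow_nonneg (hC k) _) h1 hp.le
    have h0 : 0 ≤ ellNorm ⊤ (fun k => A k ^ (1 / p)) ^ p + ellNorm ⊤ (fun k => B k ^ (1 / p)) ^ p :=
      add_nonneg (Real.rpow_nonneg (ellNorm_nonneg hr0 _) _)
        (Real.rpow_nonneg (ellNorm_nonneg hr0 _) _)
    rw [← Real.le_rpow_inv_iff_of_pos (ellNorm_nonneg hr0 _) h0 hp, ellNorm_top, ← one_div]
    refine Real.iSup_le (fun k => ?_) (Real.rpow_nonneg h0 _)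
    rw [abs_of_nonneg (Real.rpow_nonneg (add_nonneg (hA k) (hB k)) _)]
    exact Real.rpow_le_rpow (add_nonneg (hA k) (hB k)) (add_le_add (key A hA k) (key B hB k))
      (by positivity)
  · have h := ENNReal.toReal_pos hr0.ne' hr'
    have h1 : 1 ≤ r.toReal / p := by
      rw [one_le_div hp, ← ENNReal.ofReal_le_iff_le_toReal hr']
      exact hr
    rw [ellNorm_rpow hp h hA, ellNorm_rpow hp h hB,
      ellNorm_rpow hp h fun k => add_nonneg (hA k) (hB k)]
    exact Real.Lp_add_le_of_nonneg _ h1 (fun k _ => hA k) fun k _ => hB k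

/-- Minkowski's inequality in the two-dimensional `ℓ^α`, for a sum of finitely many vectors. -/
theorem Lp_two_sum_le {ι : Type*} (s : Finset ι) {α : ℝ} (hα : 1 ≤ α) {x y : ι → ℝ}
    (hx : ∀ k, 0 ≤ x k) (hy : ∀ k, 0 ≤ y k) :
    ((∑ k ∈ s, x k) ^ α + (∑ k ∈ s, y k) ^ α) ^ (1 / α) ≤
      ∑ k ∈ s, (x k ^ α + y k ^ α) ^ (1 / α) := by
  classical
  have hα0 : α ≠ 0 := by positivity
  induction s using Finset.induction_on with
  | empty => simp [hα0]
  | insert a s ha ih =>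
    rw [Finset.sum_insert ha, Finset.sum_insert ha, Finset.sum_insert ha]
    have := Real.Lp_add_le_of_nonneg (Finset.univ : Finset (Fin 2)) (f := ![x a, y a])
      (g := ![∑ k ∈ s, x k, ∑ k ∈ s, y k]) hα
      (fun i _ => by fin_cases i <;> simp [hx, hy])
      (fun i _ => by fin_cases i <;> simp [hx, hy, Finset.sum_nonneg])
    simp only [Fin.sum_univ_two, Matrix.cons_val_zero, Matrix.cons_val_one] at this
    linarith

/-- The reverse Minkowski inequality in `ℓ^{q/p}`, where `q / p ≤ 1`. -/
theorem le_ellNorm_rpow_add {p : ℝ} (hp : 0 < p) {q : ℝ≥0∞} (hq : 0 < q)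
    (hqp : q ≤ ENNReal.ofReal p) {A B : Fin n → ℝ} (hA : ∀ k, 0 ≤ A k) (hB : ∀ k, 0 ≤ B k) :
    ellNorm q (fun k => A k ^ (1 / p)) ^ p + ellNorm q (fun k => B k ^ (1 / p)) ^ p ≤
      ellNorm q (fun k => (A k + B k) ^ (1 / p)) ^ p := by
  have hq' : q ≠ ⊤ := (hqp.trans_lt ENNReal.ofReal_lt_top).ne
  have h := ENNReal.toReal_pos hq.ne' hq'
  have hle : q.toReal ≤ p := ENNReal.toReal_le_of_le_ofReal hp.le hqp
  have h1 : 1 ≤ p / q.toReal := by rwa [one_le_div h]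
  have h0 : 0 < p / q.toReal := by positivity
  rw [ellNorm_rpow hp h hA, ellNorm_rpow hp h hB,
    ellNorm_rpow hp h fun k => add_nonneg (hA k) (hB k)]
  have key := Lp_two_sum_le Finset.univ h1 (x := fun k => A k ^ (q.toReal / p))
    (y := fun k => B k ^ (q.toReal / p)) (fun k => Real.rpow_nonneg (hA k) _)
    fun k => Real.rpow_nonneg (hB k) _
  have e : ∀ C : Fin n → ℝ, (∀ k, 0 ≤ C k) → ∀ k,
      (C k ^ (q.toReal / p)) ^ (p / q.toReal) = C k := by
    intro C hC k
    rw [← Real.rpow_mul (hC k), show q.toReal / p * (p / q.toReal) = 1 by field_simp,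
      Real.rpow_one]
  simp only [e A hA, e B hB, one_div_div] at key ⊢
  have h3 := Real.rpow_le_rpow (Real.rpow_nonneg (add_nonneg
    (Real.rpow_nonneg (Finset.sum_nonneg fun k _ => Real.rpow_nonneg (hA k) _) _)
    (Real.rpow_nonneg (Finset.sum_nonneg fun k _ => Real.rpow_nonneg (hB k) _) _)) _) key h0.le
  rwa [← Real.rpow_mul (add_nonneg (Real.rpow_nonneg (Finset.sum_nonneg fun k _ =>
      Real.rpow_nonneg (hA k) _) _) (Real.rpow_nonneg (Finset.sum_nonneg fun k _ =>
      Real.rpow_nonneg (hB k) _) _)),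
    show q.toReal / p * (p / q.toReal) = 1 by field_simp, Real.rpow_one] at h3

end EllNorm

/-- The generalized contraction property (RF5) of a functional with domain `ℝ^X`. -/
def GenContraction (p : ℝ) {X : Type*} (E : (X → ℝ) → ℝ) : Prop :=
  ∀ q r : ℝ≥0∞, 0 < q → q ≤ ENNReal.ofReal p → ENNReal.ofReal p ≤ r →
    ∀ m n : ℕ, 0 < m → 0 < n → ∀ T : (Fin m → ℝ) → (Fin n → ℝ),
    (∀ x y : Fin m → ℝ, ellNorm r (T x - T y) ≤ ellNorm q (x - y)) → T 0 = 0 →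
    ∀ u : Fin m → X → ℝ,
      ellNorm r (fun k : Fin n => E (fun x => T (fun j => u j x) k) ^ (1 / p)) ≤
        ellNorm q (fun j : Fin m => E (u j) ^ (1 / p))

namespace GenContraction

variable {p : ℝ} {X Y : Type*} {E E' : (X → ℝ) → ℝ}

theorem abs_sub_rpow (hp : 0 < p) (x y : X) : GenContraction p fun u => |u x - u y| ^ p := by
  intro q r hq _ hpr m n _ _ T hT _ u
  have hr : 0 < r := (ENNReal.ofReal_pos.2 hp).trans_le hpr
  simp only [one_div, Real.rpow_rpow_inv (abs_nonneg _) hp.ne']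
  exact (ellNorm_mono hr fun k => (abs_abs _).le).trans
    ((hT (fun j => u j x) fun j => u j y).trans (ellNorm_mono hq fun j => (abs_abs _).ge))

theorem comp (h : GenContraction p E) (f : X → Y) :
    GenContraction p fun u : Y → ℝ => E fun x => u (f x) := by
  intro q r hq hqp hpr m n hm hn T hT hT0 u
  exact h q r hq hqp hpr m n hm hn T hT hT0 fun j x => u j (f x)

theorem add (hp : 0 < p) (h : GenContraction p E) (h' : GenContraction p E') (h0 : ∀ u, 0 ≤ E u)
    (h0' : ∀ u, 0 ≤ E' u) : GenContraction p fun u => E u + E' u := by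
  intro q r hq hqp hpr m n hm hn T hT hT0 u
  have hr : 0 < r := (ENNReal.ofReal_pos.2 hp).trans_le hpr
  rw [← Real.rpow_le_rpow_iff (ellNorm_nonneg hr _) (ellNorm_nonneg hq _) hp]
  refine (ellNorm_rpow_add_le hp hpr (fun _ => h0 _) fun _ => h0' _).trans
    (le_trans (add_le_add ?_ ?_) (le_ellNorm_rpow_add hp hq hqp (fun _ => h0 _) fun _ => h0' _))
  · exact Real.rpow_le_rpow (ellNorm_nonneg hr _)
      (h q r hq hqp hpr m n hm hn T hT hT0 u) hp.le
  · exact Real.rpow_le_rpow (ellNorm_nonneg hr _)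
      (h' q r hq hqp hpr m n hm hn T hT hT0 u) hp.le

theorem smul (hp : 0 < p) (h : GenContraction p E) (h0 : ∀ u, 0 ≤ E u) {c : ℝ} (hc : 0 ≤ c) :
    GenContraction p fun u => c * E u := by
  intro q r hq hqp hpr m n hm hn T hT hT0 u
  have hr : 0 < r := (ENNReal.ofReal_pos.2 hp).trans_le hpr
  simp only [Real.mul_rpow hc (h0 _)]
  rw [ellNorm_smul hr (by positivity), ellNorm_smul hq (by positivity)]
  exact mul_le_mul_of_nonneg_left (h q r hq hqp hpr m n hm hn T hT hT0 u) (by positivity)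

theorem sum {ι : Type*} (hp : 0 < p) (s : Finset ι) {F : ι → (X → ℝ) → ℝ}
    (h : ∀ i, GenContraction p (F i)) (h0 : ∀ i u, 0 ≤ F i u) :
    GenContraction p fun u => ∑ i ∈ s, F i u := by
  classical
  induction s using Finset.induction_on with
  | empty =>
    intro q r hq _ hpr m n _ _ T _ _ u
    have hr : 0 < r := (ENNReal.ofReal_pos.2 hp).trans_le hpr
    have := ellNorm_smul hr le_rfl (fun _ : Fin n => (0 : ℝ))
    simp only [Finset.sum_empty, zero_mul, Real.zero_rpow (one_div_pos.2 hp).ne'] at this ⊢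
    rw [this]
    exact ellNorm_nonneg hq _
  | insert a s ha ih =>
    simp only [Finset.sum_insert ha]
    exact (h a).add hp ih (h0 a) fun u => Finset.sum_nonneg fun i _ => h0 i u

theorem of_tendsto {ι : Type*} {l : Filter ι} [l.NeBot] (hp : 0 < p) {F : ι → (X → ℝ) → ℝ}
    (h : ∀ i, GenContraction p (F i))
    (hE : ∀ u, Filter.Tendsto (fun i => F i u) l (nhds (E u))) : GenContraction p E := by
  intro q r hq hqp hpr m n hm hn T hT hT0 u
  have hr : 0 < r := (ENNReal.ofReal_pos.2 hp).trans_le hpr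
  refine le_of_tendsto_of_tendsto'
    (((continuous_ellNorm hr).tendsto _).comp (tendsto_pi_nhds.2 fun k => (hE _).rpow_const ?_))
    (((continuous_ellNorm hq).tendsto _).comp (tendsto_pi_nhds.2 fun j => (hE _).rpow_const ?_))
    fun i => h i q r hq hqp hpr m n hm hn T hT hT0 u
  all_goals exact Or.inr (by positivity)

/-- The case `T(x, y) = x + y` of (RF5). -/
theorem add_le (hp : 1 ≤ p) (h : GenContraction p E) (h0 : ∀ u, 0 ≤ E u) (u v : X → ℝ) :
    E (u + v) ^ (1 / p) ≤ E u ^ (1 / p) + E v ^ (1 / p) := by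
  have hp0 : 0 < p := by linarith
  have h1 : (1 : ℝ≥0∞) ≤ ENNReal.ofReal p := by simpa using hp
  have := h 1 (ENNReal.ofReal p) one_pos h1 le_rfl 2 1 two_pos one_pos
    (fun x _ => x 0 + x 1) (fun x y => by
      rw [ellNorm_fin_one (by simpa using hp0), ellNorm_one_fin_two]
      simp only [Pi.sub_apply]
      rw [add_sub_add_comm]
      exact abs_add_le _ _) (by ext; simp) ![u, v]
  rw [ellNorm_fin_one (by simpa using hp0), ellNorm_one_fin_two] at this
  simp only [Matrix.cons_val_zero, Matrix.cons_val_one] at this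
  rwa [abs_of_nonneg (Real.rpow_nonneg (h0 _) _), abs_of_nonneg (Real.rpow_nonneg (h0 _) _),
    abs_of_nonneg (Real.rpow_nonneg (h0 _) _)] at this

/-- The scalar case of (RF5): a form does not increase under `1`-Lipschitz maps fixing `0`. -/
theorem comp_lipschitz_le (hp : 0 < p) (h : GenContraction p E) (h0 : ∀ u, 0 ≤ E u) {φ : ℝ → ℝ}
    (hφ : ∀ s t, |φ s - φ t| ≤ |s - t|) (hφ0 : φ 0 = 0) (u : X → ℝ) :
    E (fun x => φ (u x)) ≤ E u := by
  have hp' : (0 : ℝ≥0∞) < ENNReal.ofReal p := by simpa using hp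
  have := h (ENNReal.ofReal p) (ENNReal.ofReal p) hp' le_rfl le_rfl 1 1 one_pos one_pos
    (fun x _ => φ (x 0)) (fun x y => by
      rw [ellNorm_fin_one hp', ellNorm_fin_one hp']
      exact hφ _ _) (by ext; simp [hφ0]) fun _ => u
  rw [ellNorm_fin_one hp', ellNorm_fin_one hp', abs_of_nonneg (Real.rpow_nonneg (h0 _) _),
    abs_of_nonneg (Real.rpow_nonneg (h0 _) _)] at this
  exact (Real.rpow_le_rpow_iff (h0 _) (h0 _) (by positivity)).1 this

end GenContraction

/-! ### Forms on three points -/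

/-- A homogeneous functional on `ℝ^3` with the generalized contraction property that vanishes on
constants: a possibly degenerate `p`-resistance form on three points. -/
structure IsPreForm (p : ℝ) (E : (Fin 3 → ℝ) → ℝ) : Prop where
  nonneg : ∀ u, 0 ≤ E u
  smul : ∀ (a : ℝ) (u : Fin 3 → ℝ), E (fun i => a * u i) = |a| ^ p * E u
  const : ∀ c : ℝ, E (fun _ => c) = 0
  contr : GenContraction p E

/-- A form on three points that is invariant under all permutations of the points. -/
structure IsSymmForm (p : ℝ) (E : (Fin 3 → ℝ) → ℝ) : Prop extends IsPreForm p E where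
  symm : ∀ (σ : Equiv.Perm (Fin 3)) (u : Fin 3 → ℝ), E (fun i => u (σ i)) = E u

/-- The conductance of a symmetric form: the energy of the indicator function of a point. All
symmetric forms of conductance `1` are comparable, see `IsSymmForm.le_refEnergy` and
`IsSymmForm.refEnergy_le`. -/
def conductance (E : (Fin 3 → ℝ) → ℝ) : ℝ := E (Pi.single 0 1)

/-- The `p`-energy of the triangle graph. -/
def refEnergy (p : ℝ) (u : Fin 3 → ℝ) : ℝ :=
  |u 0 - u 1| ^ p + |u 1 - u 2| ^ p + |u 2 - u 0| ^ p

theorem abs_sub_rpow_le_refEnergy {p : ℝ} (hp : 0 < p) (u : Fin 3 → ℝ) (x y : Fin 3) :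
    |u x - u y| ^ p ≤ refEnergy p u := by
  have h01 := Real.rpow_nonneg (abs_nonneg (u 0 - u 1)) p
  have h12 := Real.rpow_nonneg (abs_nonneg (u 1 - u 2)) p
  have h20 := Real.rpow_nonneg (abs_nonneg (u 2 - u 0)) p
  unfold refEnergy
  fin_cases x <;> fin_cases y <;> simp [hp.ne']
  any_goals positivity
  all_goals first | linarith | (rw [abs_sub_comm]; linarith)

theorem refEnergy_nonneg (p : ℝ) (u : Fin 3 → ℝ) : 0 ≤ refEnergy p u := by
  unfold refEnergy
  positivity

theorem continuous_refEnergy {p : ℝ} (hp : 0 < p) : Continuous (refEnergy p) := by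
  have h : ∀ i j : Fin 3, Continuous fun u : Fin 3 → ℝ => |u i - u j| ^ p := fun i j =>
    Continuous.rpow_const (by fun_prop) fun _ => Or.inr hp.le
  exact ((h 0 1).add (h 1 2)).add (h 2 0)

theorem isSymmForm_refEnergy {p : ℝ} (hp : 0 < p) : IsSymmForm p (refEnergy p) where
  nonneg := refEnergy_nonneg p
  smul a u := by
    simp only [refEnergy, ← mul_sub, abs_mul, Real.mul_rpow (abs_nonneg _) (abs_nonneg _)]
    ring
  const c := by simp [refEnergy, hp.ne']
  contr := ((GenContraction.abs_sub_rpow hp 0 1).add hp (GenContraction.abs_sub_rpow hp 1 2)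
    (fun _ => by positivity) fun _ => by positivity).add hp (GenContraction.abs_sub_rpow hp 2 0)
    (fun _ => by positivity) fun _ => by positivity
  symm σ u := by
    have h : ∀ v : Fin 3 → ℝ, refEnergy p v = (∑ i, ∑ j, |v i - v j| ^ p) / 2 := by
      intro v
      simp only [refEnergy, Fin.sum_univ_three, sub_self, abs_zero, Real.zero_rpow hp.ne',
        abs_sub_comm (v 1) (v 0), abs_sub_comm (v 2) (v 1), abs_sub_comm (v 0) (v 2)]
      ring
    rw [h, h, ← Equiv.sum_comp σ (fun i => ∑ j, |u i - u j| ^ p)]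
    congr 1
    exact Finset.sum_congr rfl fun i _ => Equiv.sum_comp σ (fun j => |u (σ i) - u j| ^ p)

theorem conductance_refEnergy {p : ℝ} (hp : 0 < p) : conductance (refEnergy p) = 2 := by
  simp [conductance, refEnergy, hp.ne']
  norm_num

theorem isSymmForm_const_mul {p : ℝ} (hp : 0 < p) {E : (Fin 3 → ℝ) → ℝ} (h : IsSymmForm p E)
    {c : ℝ} (hc : 0 ≤ c) : IsSymmForm p fun u => c * E u where
  nonneg u := mul_nonneg hc (h.nonneg u)
  smul a u := by rw [h.smul]; ring
  const a := by rw [h.const, mul_zero]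
  contr := h.contr.smul hp h.nonneg hc
  symm σ u := by rw [h.symm]

theorem isSymmForm_sum {p : ℝ} (hp : 0 < p) {ι : Type*} (s : Finset ι)
    {F : ι → (Fin 3 → ℝ) → ℝ} (h : ∀ i, IsSymmForm p (F i)) :
    IsSymmForm p fun u => ∑ i ∈ s, F i u where
  nonneg u := Finset.sum_nonneg fun i _ => (h i).nonneg u
  smul a u := by simp only [(h _).smul, Finset.mul_sum]
  const a := by simp only [(h _).const, Finset.sum_const_zero]
  contr := GenContraction.sum hp s (fun i => (h i).contr) fun i => (h i).nonneg
  symm σ u := by simp only [(h _).symm σ u]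

theorem isSymmForm_of_tendsto {p : ℝ} (hp : 0 < p) {ι : Type*} {l : Filter ι} [l.NeBot]
    {F : ι → (Fin 3 → ℝ) → ℝ} {E : (Fin 3 → ℝ) → ℝ} (h : ∀ i, IsSymmForm p (F i))
    (hE : ∀ u, Filter.Tendsto (fun i => F i u) l (nhds (E u))) : IsSymmForm p E where
  nonneg u := ge_of_tendsto' (hE u) fun i => (h i).nonneg u
  smul a u := tendsto_nhds_unique (hE _) (by simpa only [(h _).smul] using (hE u).const_mul _)
  const a := tendsto_nhds_unique (hE _) (by simp only [(h _).const]; exact tendsto_const_nhds)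
  contr := GenContraction.of_tendsto hp (fun i => (h i).contr) hE
  symm σ u := tendsto_nhds_unique (hE _) (by simpa only [(h _).symm σ u] using hE u)

namespace IsPreForm

variable {p : ℝ} {E : (Fin 3 → ℝ) → ℝ}

theorem rpow_add_le (hp : 1 ≤ p) (h : IsPreForm p E) (u v : Fin 3 → ℝ) :
    E (u + v) ^ (1 / p) ≤ E u ^ (1 / p) + E v ^ (1 / p) :=
  h.contr.add_le hp h.nonneg u v

theorem rpow_smul (hp : 0 < p) (h : IsPreForm p E) (a : ℝ) (u : Fin 3 → ℝ) :
    E (fun i => a * u i) ^ (1 / p) = |a| * E u ^ (1 / p) := by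
  rw [h.smul, Real.mul_rpow (by positivity) (h.nonneg u), one_div,
    Real.rpow_rpow_inv (abs_nonneg _) hp.ne']

theorem neg (h : IsPreForm p E) (u : Fin 3 → ℝ) : E (fun i => -u i) = E u := by
  simpa using h.smul (-1) u

theorem add_const (hp : 1 ≤ p) (h : IsPreForm p E) (u : Fin 3 → ℝ) (c : ℝ) :
    E (fun i => u i + c) = E u := by
  have hp0 : 0 < p := by linarith
  have key : ∀ (u : Fin 3 → ℝ) (c : ℝ), E (fun i => u i + c) ≤ E u := by
    intro u c
    have := h.rpow_add_le hp u fun _ => c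
    rw [h.const, Real.zero_rpow (by positivity), add_zero] at this
    exact (Real.rpow_le_rpow_iff (h.nonneg _) (h.nonneg _) (by positivity)).1 this
  refine le_antisymm (key u c) ?_
  simpa using key (fun i => u i + c) (-c)

/-- Every form on three points is dominated by the energy of the triangle graph. -/
theorem le_refEnergy (hp : 1 ≤ p) (h : IsPreForm p E) {M : ℝ} (h1 : E (Pi.single 1 1) ≤ M)
    (h2 : E (Pi.single 2 1) ≤ M) (u : Fin 3 → ℝ) : E u ≤ 2 ^ p * M * refEnergy p u := by
  have hp0 : 0 < p := by linarith
  have hM : 0 ≤ M := (h.nonneg _).trans h1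
  have hd : ∀ x y, |u x - u y| ≤ refEnergy p u ^ (1 / p) := fun x y => by
    rw [one_div, Real.le_rpow_inv_iff_of_pos (abs_nonneg _) (refEnergy_nonneg p u) hp0]
    exact abs_sub_rpow_le_refEnergy hp0 u x y
  have e : (fun i => u i + -u 0) = (fun i => (u 1 - u 0) * (Pi.single 1 1 : Fin 3 → ℝ) i) +
      fun i => (u 2 - u 0) * (Pi.single 2 1 : Fin 3 → ℝ) i := by
    ext i
    fin_cases i <;> simp [sub_eq_add_neg]
  have hsum := h.rpow_add_le hp (fun i => (u 1 - u 0) * (Pi.single 1 1 : Fin 3 → ℝ) i)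
    fun i => (u 2 - u 0) * (Pi.single 2 1 : Fin 3 → ℝ) i
  rw [← e, h.add_const hp, h.rpow_smul hp0, h.rpow_smul hp0] at hsum
  have hm : ∀ {t : ℝ}, 0 ≤ t → t ≤ M → t ^ (1 / p) ≤ M ^ (1 / p) := fun h0 h =>
    Real.rpow_le_rpow h0 h (by positivity)
  have hR : 0 ≤ refEnergy p u ^ (1 / p) := Real.rpow_nonneg (refEnergy_nonneg p u) _
  have hb : E u ^ (1 / p) ≤ 2 * M ^ (1 / p) * refEnergy p u ^ (1 / p) := by
    have := mul_le_mul (hd 1 0) (hm (h.nonneg _) h1) (Real.rpow_nonneg (h.nonneg _) _) hR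
    have := mul_le_mul (hd 2 0) (hm (h.nonneg _) h2) (Real.rpow_nonneg (h.nonneg _) _) hR
    linarith
  have := Real.rpow_le_rpow (Real.rpow_nonneg (h.nonneg _) _) hb hp0.le
  rwa [Real.mul_rpow (by positivity) hR, Real.mul_rpow zero_le_two (by positivity), one_div,
    Real.rpow_inv_rpow (h.nonneg _) hp0.ne', Real.rpow_inv_rpow hM hp0.ne',
    Real.rpow_inv_rpow (refEnergy_nonneg p u) hp0.ne'] at this

theorem continuous (hp : 1 ≤ p) (h : IsPreForm p E) : Continuous E := by
  have hp0 : 0 < p := by linarith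
  obtain ⟨C, hC⟩ : ∃ C, ∀ u, E u ≤ C * refEnergy p u :=
    ⟨_, h.le_refEnergy hp (le_max_left _ _) (le_max_right _ _)⟩
  have hroot : Continuous fun u => E u ^ (1 / p) := by
    rw [continuous_iff_continuousAt]
    intro u
    -- `|E(v)^{1/p} - E(u)^{1/p}| ≤ E(v - u)^{1/p} ≤ (C * refEnergy (v - u))^{1/p} → 0`.
    have hlim : Filter.Tendsto (fun v : Fin 3 → ℝ => (C * refEnergy p (v - u)) ^ (1 / p))
        (nhds u) (nhds 0) := by
      have hc : Continuous fun v : Fin 3 → ℝ => (C * refEnergy p (v - u)) ^ (1 / p) :=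
        Continuous.rpow_const (continuous_const.mul
          ((continuous_refEnergy hp0).comp (by fun_prop))) fun _ => Or.inr (by positivity)
      have := hc.tendsto u
      rwa [sub_self, show refEnergy p 0 = 0 by simp [refEnergy, hp0.ne'], mul_zero,
        Real.zero_rpow (by positivity)] at this
    refine tendsto_iff_dist_tendsto_zero.2 (squeeze_zero (fun _ => dist_nonneg) (fun v => ?_) hlim)
    have hb : E (v - u) ^ (1 / p) ≤ (C * refEnergy p (v - u)) ^ (1 / p) :=
      Real.rpow_le_rpow (h.nonneg _) (hC _) (by positivity)
    have h1 := h.rpow_add_le hp (v - u) u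
    have h2 := h.rpow_add_le hp (fun i => -(v - u) i) v
    rw [h.neg, show (fun i => -(v - u) i) + v = u by ext; simp] at h2
    rw [sub_add_cancel] at h1
    rw [Real.dist_eq, abs_le]
    constructor <;> linarith
  have : E = fun u => (E u ^ (1 / p)) ^ p := by
    ext u
    rw [one_div, Real.rpow_inv_rpow (h.nonneg _) hp0.ne']
  rw [this]
  exact hroot.rpow_const fun _ => Or.inr hp0.le

end IsPreForm

namespace IsSymmForm

variable {p : ℝ} {E : (Fin 3 → ℝ) → ℝ}

theorem apply_single (h : IsSymmForm p E) (i : Fin 3) : E (Pi.single i 1) = conductance E := by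
  rw [conductance, ← h.symm (Equiv.swap 0 i)]
  congr 1
  ext j
  rw [Pi.single_apply, Pi.single_apply]
  congr 1
  rw [Equiv.swap_apply_eq_iff]
  simp

/-- The resistance between two points is controlled by the conductance: cutting off a function at
half its increment between the two points yields a multiple of the indicator function of a point,
up to sign and constants. -/
theorem abs_sub_rpow_le (hp : 1 ≤ p) (h : IsSymmForm p E) (u : Fin 3 → ℝ) (x y : Fin 3) :
    conductance E * |u x - u y| ^ p ≤ 2 ^ p * E u := by
  have hp0 : 0 < p := by linarith
  wlog hxy : u x < u y generalizing x y
  · rcases eq_or_lt_of_le (not_lt.1 hxy) with h' | h'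
    · rw [h', sub_self, abs_zero, Real.zero_rpow hp0.ne', mul_zero]
      exact mul_nonneg (by positivity) (h.nonneg u)
    · rw [abs_sub_comm]
      exact this y x h'
  have hne : x ≠ y := fun h => by simp [h] at hxy
  obtain ⟨z, hzx, hzy, hz⟩ : ∃ z, z ≠ x ∧ z ≠ y ∧ ∀ i : Fin 3, i = x ∨ i = y ∨ i = z := by
    clear hxy
    revert x y
    decide
  set d := u y - u x
  have hd0 : 0 < d := sub_pos.2 hxy
  have hd2 : 0 ≤ d / 2 := by linarith
  suffices hs : (d / 2) ^ p * conductance E ≤ E u by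
    rw [abs_sub_comm, abs_of_pos hd0]
    rw [Real.div_rpow hd0.le zero_le_two] at hs
    have h2 : (0 : ℝ) < 2 ^ p := by positivity
    calc conductance E * d ^ p = 2 ^ p * (d ^ p / 2 ^ p * conductance E) := by field_simp
      _ ≤ _ := by gcongr
  have hu : E u = E fun i => u i + -u x := (h.add_const hp u _).symm
  rw [hu]
  rcases le_total (u z - u x) (d / 2) with hzd | hzd
  · have := h.contr.comp_lipschitz_le hp0 h.nonneg (φ := fun s => max (s - d / 2) 0)
      (fun s t => by simpa using abs_max_sub_max_le_abs (s - d / 2) (t - d / 2) 0)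
      (by simp [hd2]) fun i => u i + -u x
    refine le_trans (le_of_eq ?_) this
    rw [← h.apply_single y, ← abs_of_nonneg hd2, ← h.smul, abs_of_nonneg hd2]
    congr 1
    ext i
    rcases hz i with rfl | rfl | rfl
    · simp [hne, hd2]
    · rw [Pi.single_eq_same, max_eq_left (by linarith)]
      linarith
    · rw [Pi.single_eq_of_ne hzy, max_eq_right (by linarith), mul_zero]
  · have := h.contr.comp_lipschitz_le hp0 h.nonneg (φ := fun s => max (min s (d / 2)) 0)
      (fun s t => (abs_max_sub_max_le_abs _ _ _).trans
        (by simpa using abs_min_sub_min_le_max s (d / 2) t (d / 2)))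
      (by simp) fun i => u i + -u x
    refine le_trans (le_of_eq ?_) this
    rw [← h.apply_single x, show (d / 2) ^ p = |-(d / 2)| ^ p by rw [abs_neg, abs_of_nonneg hd2],
      ← h.smul, ← h.add_const hp _ (d / 2)]
    congr 1
    ext i
    rcases hz i with rfl | rfl | rfl
    · simp [hd2]
    · rw [Pi.single_eq_of_ne hne.symm, min_eq_right (by linarith), max_eq_left (by linarith)]
      ring
    · rw [Pi.single_eq_of_ne hzx, min_eq_right (by linarith), max_eq_left (by linarith)]
      ring

theorem refEnergy_le (hp : 1 ≤ p) (h : IsSymmForm p E) (u : Fin 3 → ℝ) :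
    conductance E * refEnergy p u ≤ 3 * 2 ^ p * E u := by
  have h1 := h.abs_sub_rpow_le hp u 0 1
  have h2 := h.abs_sub_rpow_le hp u 1 2
  have h3 := h.abs_sub_rpow_le hp u 2 0
  rw [refEnergy]
  linarith

theorem le_refEnergy (hp : 1 ≤ p) (h : IsSymmForm p E) (u : Fin 3 → ℝ) :
    E u ≤ 2 ^ p * conductance E * refEnergy p u :=
  h.toIsPreForm.le_refEnergy hp (h.apply_single 1).le (h.apply_single 2).le u

theorem conductance_nonneg (h : IsSymmForm p E) : 0 ≤ conductance E := h.nonneg _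

end IsSymmForm

/-! ### The renormalization operator on forms on three points -/

/-- A function on `V₁` is encoded by its values `w i j` at the points `f_i(q_j)`; as
`f_i(q_j) = f_j(q_i)` and `f_i(q_i) = q_i`, this is a symmetric matrix, and it extends the function
`u` on `V₀` if its diagonal is `u`. -/
def IsExtension (u : Fin 3 → ℝ) (w : Fin 3 → Fin 3 → ℝ) : Prop :=
  (∀ i j, w i j = w j i) ∧ ∀ i, w i i = u i

/-- The trace on `V₀` of the sum of the copies of `E` on the three cells (the operator
`E ↦ R_{1,1}(E)|_{V₀}`). -/
def renormTrace (E : (Fin 3 → ℝ) → ℝ) (u : Fin 3 → ℝ) : ℝ :=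
  sInf {t | ∃ w, IsExtension u w ∧ t = ∑ i, E (w i)}

theorem isExtension_max (u : Fin 3 → ℝ) : IsExtension u fun i j => max (u i) (u j) :=
  ⟨fun _ _ => max_comm _ _, fun _ => max_self _⟩

section RenormTrace

variable {p : ℝ} {E E' : (Fin 3 → ℝ) → ℝ} {u : Fin 3 → ℝ} {w : Fin 3 → Fin 3 → ℝ}

theorem renormTrace_le (h : ∀ u, 0 ≤ E u) (hw : IsExtension u w) :
    renormTrace E u ≤ ∑ i, E (w i) := by
  refine csInf_le ⟨0, ?_⟩ ⟨w, hw, rfl⟩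
  rintro _ ⟨w, _, rfl⟩
  exact Finset.sum_nonneg fun _ _ => h _

theorem le_renormTrace {c : ℝ} (h : ∀ w, IsExtension u w → c ≤ ∑ i, E (w i)) :
    c ≤ renormTrace E u := by
  refine le_csInf ⟨_, _, isExtension_max u, rfl⟩ ?_
  rintro _ ⟨w, hw, rfl⟩
  exact h w hw

theorem le_mul_renormTrace {a c : ℝ} (hc : 0 < c)
    (h : ∀ w, IsExtension u w → a ≤ c * ∑ i, E (w i)) : a ≤ c * renormTrace E u := by
  rw [← div_le_iff₀' hc]
  exact le_renormTrace fun w hw => (div_le_iff₀' hc).2 (h w hw)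

theorem renormTrace_nonneg (h : ∀ u, 0 ≤ E u) (u : Fin 3 → ℝ) : 0 ≤ renormTrace E u :=
  le_renormTrace fun _ _ => Finset.sum_nonneg fun _ _ => h _

theorem exists_sum_lt_renormTrace_add (E : (Fin 3 → ℝ) → ℝ) (u : Fin 3 → ℝ) {ε : ℝ}
    (hε : 0 < ε) : ∃ w, IsExtension u w ∧ ∑ i, E (w i) < renormTrace E u + ε := by
  obtain ⟨_, ⟨w, hw, rfl⟩, h⟩ := Real.lt_sInf_add_pos
    (s := {t | ∃ w, IsExtension u w ∧ t = ∑ i, E (w i)}) ⟨_, _, isExtension_max u, rfl⟩ hε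
  exact ⟨w, hw, h⟩

theorem renormTrace_le_mul {c : ℝ} (hc : 0 < c) (h : ∀ u, 0 ≤ E u) (hE : ∀ u, E u ≤ c * E' u)
    (u : Fin 3 → ℝ) : renormTrace E u ≤ c * renormTrace E' u := by
  refine le_mul_renormTrace hc fun w hw => (renormTrace_le h hw).trans ?_
  rw [Finset.mul_sum]
  exact Finset.sum_le_sum fun i _ => hE _

theorem renormTrace_const_mul {c : ℝ} (hc : 0 < c) (h : ∀ u, 0 ≤ E u) :
    renormTrace (fun u => c * E u) u = c * renormTrace E u := by
  refine le_antisymm (renormTrace_le_mul hc (fun u => mul_nonneg hc.le (h u))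
    (fun _ => le_rfl) u) ?_
  rw [← le_inv_mul_iff₀ hc]
  refine renormTrace_le_mul (inv_pos.2 hc) h (fun u => ?_) u
  rw [inv_mul_cancel_left₀ hc.ne']

theorem iterate_renormTrace_nonneg (h : ∀ u, 0 ≤ E u) (n : ℕ) (u : Fin 3 → ℝ) :
    0 ≤ renormTrace^[n] E u := by
  induction n generalizing u with
  | zero => exact h u
  | succ n ih =>
    rw [Function.iterate_succ_apply']
    exact renormTrace_nonneg ih u

theorem iterate_renormTrace_le_mul {c : ℝ} (hc : 0 < c) (h : ∀ u, 0 ≤ E u)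
    (hE : ∀ u, E u ≤ c * E' u) (n : ℕ) (u : Fin 3 → ℝ) :
    renormTrace^[n] E u ≤ c * renormTrace^[n] E' u := by
  induction n generalizing u with
  | zero => exact hE u
  | succ n ih =>
    rw [Function.iterate_succ_apply', Function.iterate_succ_apply']
    exact renormTrace_le_mul hc (iterate_renormTrace_nonneg h n) ih u

theorem isSymmForm_renormTrace (hp : 1 ≤ p) (h : IsSymmForm p E) :
    IsSymmForm p (renormTrace E) := by
  have hp0 : 0 < p := by linarith
  have hconst : ∀ c : ℝ, renormTrace E (fun _ => c) = 0 := fun c =>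
    le_antisymm ((renormTrace_le h.nonneg (w := fun _ _ => c) ⟨fun _ _ => rfl, fun _ => rfl⟩).trans
      (by simp [h.const])) (renormTrace_nonneg h.nonneg _)
  refine ⟨⟨renormTrace_nonneg h.nonneg, ?_, hconst, ?_⟩, ?_⟩
  · have key : ∀ a : ℝ, a ≠ 0 → ∀ u,
        renormTrace E (fun i => a * u i) ≤ |a| ^ p * renormTrace E u := by
      intro a ha u
      refine le_mul_renormTrace (by positivity) fun w hw => ?_
      refine (renormTrace_le h.nonneg (w := fun i j => a * w i j)
        ⟨fun i j => by simp only [hw.1 i j], fun i => by simp only [hw.2]⟩).trans (le_of_eq ?_)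
      simp only [h.smul, Finset.mul_sum]
    intro a u
    rcases eq_or_ne a 0 with rfl | ha
    · simp [hconst, hp0.ne']
    · refine le_antisymm (key a ha u) ?_
      have := key a⁻¹ (inv_ne_zero ha) fun i => a * u i
      simp only [inv_mul_cancel_left₀ ha] at this
      rwa [abs_inv, Real.inv_rpow (abs_nonneg _), le_inv_mul_iff₀ (by positivity)] at this
  · intro q r hq hqp hpr m n hm hn T hT hT0 u
    have hr : 0 < r := (ENNReal.ofReal_pos.2 hp0).trans_le hpr
    -- The energy of functions on `V₁` has the contraction property; apply it to almost minimizers.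
    have hR : GenContraction p fun v : Fin 3 × Fin 3 → ℝ => ∑ i, E fun j => v (i, j) :=
      GenContraction.sum hp0 _ (fun i => h.contr.comp fun j => (i, j)) fun i v => h.nonneg _
    choose w hw hwlt using fun (k : ℕ) (j : Fin m) =>
      exists_sum_lt_renormTrace_add E (u j) (Nat.one_div_pos_of_nat (α := ℝ) (n := k))
    have hlim : ∀ j, Filter.Tendsto (fun k => ∑ i, E (w k j i)) Filter.atTop
        (nhds (renormTrace E (u j))) := by
      intro j
      refine tendsto_of_tendsto_of_tendsto_of_le_of_le tendsto_const_nhds ?_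
        (fun k => renormTrace_le h.nonneg (hw k j)) fun k => (hwlt k j).le
      simpa using (tendsto_const_nhds (x := renormTrace E (u j))).add
        (tendsto_one_div_add_atTop_nhds_zero_nat (𝕜 := ℝ))
    refine ge_of_tendsto' (((continuous_ellNorm hq).tendsto _).comp
      (tendsto_pi_nhds.2 fun j => (hlim j).rpow_const (Or.inr (by positivity)))) fun k => ?_
    refine le_trans (ellNorm_mono hr fun l => ?_)
      (hR q r hq hqp hpr m n hm hn T hT hT0 fun j x => w k j x.1 x.2)
    have h1 : renormTrace E (fun x => T (fun j => u j x) l) ≤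
        ∑ i, E fun x => T (fun j => w k j i x) l :=
      renormTrace_le h.nonneg (w := fun i x => T (fun j => w k j i x) l)
        ⟨fun i x => by simp only [fun j => (hw k j).1 i x],
          fun i => by simp only [fun j => (hw k j).2 i]⟩
    have h0 := renormTrace_nonneg h.nonneg fun x => T (fun j => u j x) l
    rw [abs_of_nonneg (Real.rpow_nonneg h0 _), abs_of_nonneg (Real.rpow_nonneg (h0.trans h1) _)]
    exact Real.rpow_le_rpow h0 h1 (by positivity)
  · have key : ∀ (σ : Equiv.Perm (Fin 3)) (u : Fin 3 → ℝ),
        renormTrace E (fun i => u (σ i)) ≤ renormTrace E u := by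
      intro σ u
      refine le_renormTrace fun w hw => ?_
      refine (renormTrace_le h.nonneg (w := fun i j => w (σ i) (σ j))
        ⟨fun i j => hw.1 _ _, fun i => hw.2 _⟩).trans (le_of_eq ?_)
      simp only [h.symm σ (w _)]
      exact Equiv.sum_comp σ fun i => E (w i)
    intro σ u
    refine le_antisymm (key σ u) ?_
    simpa using key σ⁻¹ fun i => u (σ i)

theorem isSymmForm_iterate_renormTrace (hp : 1 ≤ p) (h : IsSymmForm p E) (n : ℕ) :
    IsSymmForm p (renormTrace^[n] E) := by
  induction n with
  | zero => exact h
  | succ n ih =>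
    rw [Function.iterate_succ_apply']
    exact isSymmForm_renormTrace hp ih

/-- Nondegeneracy survives renormalization: an extension of the indicator function of `q_0` changes
by at least `1 / 2` on one of the two edges joining `q_0` to `q_1` through the point
`f_0(q_1) = f_1(q_0)`. -/
theorem IsSymmForm.conductance_le (hp : 1 ≤ p) (h : IsSymmForm p E) :
    conductance E ≤ 4 ^ p * conductance (renormTrace E) := by
  have hp0 : 0 < p := by linarith
  refine le_mul_renormTrace (by positivity) fun w hw => ?_
  have hsum : ∀ i, E (w i) ≤ ∑ i, E (w i) := fun i =>
    Finset.single_le_sum (f := fun i => E (w i)) (fun i _ => h.nonneg _) (Finset.mem_univ i)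
  have key : ∀ i x y, 1 / 2 ≤ |w i x - w i y| → conductance E ≤ 4 ^ p * ∑ i, E (w i) := by
    intro i x y hi
    have h1 := h.abs_sub_rpow_le hp (w i) x y
    have h2 : (1 / 2 : ℝ) ^ p ≤ |w i x - w i y| ^ p := Real.rpow_le_rpow (by norm_num) hi hp0.le
    rw [Real.div_rpow zero_le_one zero_le_two, Real.one_rpow] at h2
    have h4 : (4 : ℝ) ^ p = 2 ^ p * 2 ^ p := by
      rw [← Real.mul_rpow zero_le_two zero_le_two]; norm_num
    have h2p : (0 : ℝ) < 2 ^ p := by positivity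
    have h3 := mul_le_mul_of_nonneg_left h2 h.conductance_nonneg
    calc conductance E = 2 ^ p * (conductance E * (1 / 2 ^ p)) := by field_simp
      _ ≤ 2 ^ p * (2 ^ p * ∑ i, E (w i)) :=
        mul_le_mul_of_nonneg_left
          (h3.trans (h1.trans (mul_le_mul_of_nonneg_left (hsum i) h2p.le))) h2p.le
      _ = _ := by rw [h4]; ring
  have h00 : w 0 0 = 1 := by simp [hw.2]
  have h11 : w 1 1 = 0 := by simp [hw.2]
  rcases le_total (w 0 1) (1 / 2) with hm | hm
  · refine key 0 0 1 ?_
    rw [h00, le_abs]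
    left; linarith
  · refine key 1 0 1 ?_
    rw [h11, le_abs, hw.1 1 0]
    left; linarith

/-- Lower semicontinuity of the renormalization operator along increasing sequences. -/
theorem renormTrace_le_of_monotone (hp : 1 ≤ p) {G : ℕ → (Fin 3 → ℝ) → ℝ}
    (hG : ∀ n, IsSymmForm p (G n)) (hmono : Monotone G) (h0 : 0 < conductance (G 0))
    (hlim : ∀ v, Filter.Tendsto (fun n => G n v) Filter.atTop (nhds (E v))) {b : ℝ}
    (hb : ∀ n, renormTrace (G n) u ≤ b) : renormTrace E u ≤ b := by
  have hp0 : 0 < p := by linarith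
  have hE0 : ∀ v, 0 ≤ E v := fun v => ge_of_tendsto' (hlim v) fun n => (hG n).nonneg v
  choose w hw hwlt using fun n : ℕ =>
    exists_sum_lt_renormTrace_add (G n) u (Nat.one_div_pos_of_nat (α := ℝ) (n := n))
  have hwb : ∀ n, ∑ i, G n (w n i) ≤ b + 1 / ((n : ℝ) + 1) := fun n =>
    (hwlt n).le.trans (by gcongr; exact hb n)
  have hle1 : ∀ n : ℕ, 1 / ((n : ℝ) + 1) ≤ 1 := fun n => by
    rw [div_le_one (by positivity)]
    linarith [n.cast_nonneg (α := ℝ)]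
  have hb1 : 0 ≤ b + 1 := by
    have := Finset.sum_nonneg fun i (_ : i ∈ Finset.univ) => (hG 0).nonneg (w 0 i)
    linarith [hwb 0, hle1 0]
  -- The energy bound confines the almost minimizers `w n` to a fixed ball.
  set M : ℝ := (2 ^ p * (b + 1) / conductance (G 0)) ^ (1 / p) with hM
  have hM0 : 0 ≤ M := by positivity
  have hball : ∀ n, w n ∈ Metric.closedBall (fun i (_ : Fin 3) => u i) M := by
    intro n
    rw [Metric.mem_closedBall, dist_pi_le_iff hM0]
    intro i
    rw [dist_pi_le_iff hM0]
    intro j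
    rw [Real.dist_eq, hM, one_div, Real.le_rpow_inv_iff_of_pos (abs_nonneg _) (by positivity) hp0,
      le_div_iff₀' h0, ← (hw n).2 i]
    refine ((hG 0).abs_sub_rpow_le hp (w n i) j i).trans ?_
    gcongr
    have h1 : G 0 (w n i) ≤ G n (w n i) := hmono n.zero_le _
    have h2 : G n (w n i) ≤ ∑ i, G n (w n i) :=
      Finset.single_le_sum (f := fun i => G n (w n i)) (fun i _ => (hG n).nonneg _)
        (Finset.mem_univ i)
    linarith [hwb n, hle1 n]
  obtain ⟨w', -, φ, hφ, hconv⟩ := tendsto_subseq_of_bounded Metric.isBounded_closedBall hball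
  have hconv1 : ∀ i, Filter.Tendsto (fun n => w (φ n) i) Filter.atTop (nhds (w' i)) :=
    tendsto_pi_nhds.1 hconv
  have hconv2 : ∀ i j, Filter.Tendsto (fun n => w (φ n) i j) Filter.atTop (nhds (w' i j)) :=
    fun i => tendsto_pi_nhds.1 (hconv1 i)
  have hw' : IsExtension u w' := by
    refine ⟨fun i j => tendsto_nhds_unique (hconv2 i j) ?_,
      fun i => tendsto_nhds_unique (hconv2 i i) ?_⟩
    · simpa only [fun n => (hw n).1 i j] using hconv2 j i
    · simpa only [fun n => (hw n).2 i] using tendsto_const_nhds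
  have hm : ∀ m, ∑ i, G m (w' i) ≤ b := by
    intro m
    have h1 : Filter.Tendsto (fun n => ∑ i, G m (w (φ n) i)) Filter.atTop
        (nhds (∑ i, G m (w' i))) := tendsto_finsetSum _ fun i _ =>
      (((hG m).continuous hp).tendsto _).comp (hconv1 i)
    have h2 : Filter.Tendsto (fun n => b + 1 / ((φ n : ℝ) + 1)) Filter.atTop (nhds b) := by
      simpa using (tendsto_const_nhds (x := b)).add
        ((tendsto_one_div_add_atTop_nhds_zero_nat (𝕜 := ℝ)).comp hφ.tendsto_atTop)
    refine le_of_tendsto_of_tendsto h1 h2 ?_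
    filter_upwards [Filter.eventually_ge_atTop m] with n hn
    have hle : ∀ i, G m (w (φ n) i) ≤ G (φ n) (w (φ n) i) :=
      fun i => hmono (hn.trans (hφ.id_le n)) _
    exact (Finset.sum_le_sum fun i _ => hle i).trans (hwb (φ n))
  exact (renormTrace_le hE0 hw').trans
    (le_of_tendsto' (tendsto_finsetSum _ fun i _ => hlim (w' i)) hm)

end RenormTrace

/-! ### Existence of a symmetric eigenform -/

/-- A quasi-multiplicative sequence of positive numbers is comparable to a geometric sequence. -/
theorem exists_growth_rate {a : ℕ → ℝ} (ha : ∀ n, 0 < a n) {k K : ℝ} (hk : 0 < k) (hK : 0 < K)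
    (hlow : ∀ m n, k * a m * a n ≤ a (m + n)) (hup : ∀ m n, a (m + n) ≤ K * a m * a n) :
    ∃ c : ℝ, 0 < c ∧ ∀ n, k * a n ≤ c ^ n ∧ c ^ n ≤ K * a n := by
  have hlow' : ∀ n m, (k * a n) ^ (m + 1) ≤ k * a (n * (m + 1)) := by
    intro n m
    induction m with
    | zero => simp
    | succ m ih =>
      calc (k * a n) ^ (m + 1 + 1) = (k * a n) ^ (m + 1) * (k * a n) := pow_succ _ _
        _ ≤ k * a (n * (m + 1)) * (k * a n) := by
          have := ha n
          gcongr
        _ = k * (k * a (n * (m + 1)) * a n) := by ring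
        _ ≤ k * a (n * (m + 1) + n) := by gcongr; exact hlow _ _
        _ = _ := by rw [mul_add_one n (m + 1)]
  have hup' : ∀ n m, K * a (n * (m + 1)) ≤ (K * a n) ^ (m + 1) := by
    intro n m
    induction m with
    | zero => simp
    | succ m ih =>
      have := ha n
      calc K * a (n * (m + 1 + 1)) = K * a (n * (m + 1) + n) := by rw [mul_add_one n (m + 1)]
        _ ≤ K * (K * a (n * (m + 1)) * a n) := by gcongr; exact hup _ _
        _ = K * a (n * (m + 1)) * (K * a n) := by ring
        _ ≤ (K * a n) ^ (m + 1) * (K * a n) := by gcongr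
        _ = _ := (pow_succ _ _).symm
  have hkK : k ≤ K := by
    have h := (hlow 0 0).trans (hup 0 0)
    exact le_of_mul_le_mul_right (le_of_mul_le_mul_right h (ha 0)) (ha 0)
  -- `(k a_n)^{1/n} ≤ (K a_m)^{1/m}` for all `m` and `n`; take a number in between.
  have key : ∀ n m : ℕ, Real.log (k * a (n + 1)) / ((n : ℝ) + 1) ≤
      Real.log (K * a (m + 1)) / ((m : ℝ) + 1) := by
    intro n m
    rw [div_le_div_iff₀ (by positivity) (by positivity)]
    have h1 : (k * a (n + 1)) ^ (m + 1) ≤ (K * a (m + 1)) ^ (n + 1) := by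
      refine (hlow' (n + 1) m).trans (le_trans ?_ (hup' (m + 1) n))
      rw [mul_comm (m + 1)]
      have := ha ((n + 1) * (m + 1))
      gcongr
    have h2 := Real.log_le_log (pow_pos (mul_pos hk (ha _)) _) h1
    rw [Real.log_pow, Real.log_pow] at h2
    push_cast at h2
    linarith
  set c := ⨆ n : ℕ, Real.log (k * a (n + 1)) / ((n : ℝ) + 1)
  refine ⟨Real.exp c, Real.exp_pos c, fun n => ?_⟩
  rcases n with _ | n
  · have h0 := ha 0
    have h1 := hlow 0 0
    have h2 := hup 0 0
    simp only [add_zero, pow_zero] at h1 h2 ⊢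
    constructor
    · exact le_of_mul_le_mul_right (by linarith) h0
    · exact le_of_mul_le_mul_right (by linarith) h0
  · have e : Real.exp c ^ (n + 1) = Real.exp (c * ((n : ℝ) + 1)) := by
      rw [← Real.exp_nat_mul]; push_cast; ring_nf
    have hn : (0 : ℝ) < (n : ℝ) + 1 := by positivity
    rw [e, ← Real.log_le_iff_le_exp (mul_pos hk (ha _)), ← Real.le_log_iff_exp_le
      (mul_pos hK (ha _)), ← div_le_iff₀ hn, ← le_div_iff₀ hn]
    exact ⟨le_ciSup (f := fun n : ℕ => Real.log (k * a (n + 1)) / ((n : ℝ) + 1))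
      ⟨_, Set.forall_mem_range.2 fun j => key j 0⟩ n, ciSup_le fun j => key j n⟩

/-- The energies of the triangle graph under iterated renormalization decay geometrically, up to
constants, because their conductances are quasi-multiplicative. -/
theorem exists_iterate_refEnergy_bounds {p : ℝ} (hp : 1 ≤ p) :
    ∃ c : ℝ, 0 < c ∧ ∃ C : ℝ, 0 < C ∧ ∃ δ : ℝ, 0 < δ ∧ ∀ n,
      δ * c ^ n ≤ conductance (renormTrace^[n] (refEnergy p)) ∧
      ∀ u, renormTrace^[n] (refEnergy p) u ≤ C * c ^ n * refEnergy p u := by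
  have hp0 : 0 < p := by linarith
  have hS := isSymmForm_iterate_renormTrace hp (isSymmForm_refEnergy hp0)
  have h2p : (0 : ℝ) < 2 ^ p := by positivity
  set a : ℕ → ℝ := fun n => conductance (renormTrace^[n] (refEnergy p)) with ha_def
  have ha : ∀ n, 0 < a n := by
    intro n
    induction n with
    | zero =>
      rw [ha_def]
      simp [conductance_refEnergy hp0]
    | succ n ih =>
      have := (hS n).conductance_le hp
      rw [← Function.iterate_succ_apply' renormTrace] at this
      exact pos_of_mul_pos_right (ih.trans_le this) (by positivity)
  have hiter : ∀ m n, renormTrace^[m + n] (refEnergy p)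
      = renormTrace^[m] (renormTrace^[n] (refEnergy p)) := fun m n =>
    Function.iterate_add_apply _ _ _ _
  have hup : ∀ m n, a (m + n) ≤ 2 ^ p * a m * a n := by
    intro m n
    have := iterate_renormTrace_le_mul (mul_pos h2p (ha n)) (hS n).nonneg
      (fun u => (hS n).le_refEnergy hp u) m (Pi.single 0 1)
    rw [← hiter] at this
    calc a (m + n) ≤ 2 ^ p * a n * a m := this
      _ = _ := by ring
  have hlow : ∀ m n, (3 * 2 ^ p)⁻¹ * a m * a n ≤ a (m + n) := by
    intro m n
    have := iterate_renormTrace_le_mul (E := refEnergy p) (c := 3 * 2 ^ p / a n)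
      (div_pos (by positivity) (ha n)) (refEnergy_nonneg p) (fun u => by
        rw [div_mul_eq_mul_div, le_div_iff₀' (ha n)]
        exact (hS n).refEnergy_le hp u) m (Pi.single 0 1)
    rw [← hiter, div_mul_eq_mul_div, le_div_iff₀' (ha n)] at this
    rw [mul_assoc, inv_mul_le_iff₀ (by positivity), mul_comm]
    exact this
  obtain ⟨c, hc, hca⟩ := exists_growth_rate ha (k := (3 * 2 ^ p)⁻¹) (K := 2 ^ p)
    (by positivity) h2p hlow hup
  refine ⟨c, hc, 2 ^ p * (3 * 2 ^ p), by positivity, (2 ^ p)⁻¹, by positivity, fun n =>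
    ⟨(inv_mul_le_iff₀ h2p).2 (hca n).2, fun u => ((hS n).le_refEnergy hp u).trans ?_⟩⟩
  have h1 := (inv_mul_le_iff₀ (by positivity)).1 (hca n).1
  refine mul_le_mul_of_nonneg_right ?_ (refEnergy_nonneg p u)
  rw [mul_assoc (2 ^ p)]
  exact mul_le_mul_of_nonneg_left h1 h2p.le

/-- Superadditivity of the renormalization operator, and its upper semicontinuity, turn the Cesàro
means of the rescaled energies `c⁻ⁿ Λⁿ(E₀)` into a form `A` with `Λ(A) ≥ c A`. -/
theorem exists_isSymmForm_mul_le_renormTrace {p : ℝ} (hp : 1 ≤ p) {c C δ : ℝ} (hc : 0 < c)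
    (hδ : ∀ n, δ * c ^ n ≤ conductance (renormTrace^[n] (refEnergy p)))
    (hC : ∀ n u, renormTrace^[n] (refEnergy p) u ≤ C * c ^ n * refEnergy p u) :
    ∃ A, IsSymmForm p A ∧ δ ≤ conductance A ∧ (∀ u, A u ≤ C * refEnergy p u) ∧
      ∀ u, c * A u ≤ renormTrace A u := by
  have hp0 : 0 < p := by linarith
  have hS := isSymmForm_iterate_renormTrace hp (isSymmForm_refEnergy hp0)
  set F : ℕ → (Fin 3 → ℝ) → ℝ := fun n u => (c ^ n)⁻¹ * renormTrace^[n] (refEnergy p) u with hF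
  have hF0 : ∀ n u, 0 ≤ F n u := fun n u => mul_nonneg (by positivity) ((hS n).nonneg u)
  have hFC : ∀ n u, F n u ≤ C * refEnergy p u := fun n u => by
    rw [hF]
    refine (inv_mul_le_iff₀ (by positivity)).2 ((hC n u).trans (le_of_eq (by ring)))
  have hFδ : ∀ n, δ ≤ F n (Pi.single 0 1) := fun n => by
    rw [hF]
    refine (le_inv_mul_iff₀ (by positivity)).2 ((le_of_eq (mul_comm _ _)).trans (hδ n))
  have hFS : ∀ n, IsSymmForm p (F n) := fun n => isSymmForm_const_mul hp0 (hS n) (by positivity)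
  have hFΛ : ∀ n u, renormTrace (F n) u = c * F (n + 1) u := by
    intro n u
    rw [hF]
    simp only [Function.iterate_succ_apply']
    rw [renormTrace_const_mul (by positivity) (hS n).nonneg, pow_succ]
    field_simp
  set A : ℕ → (Fin 3 → ℝ) → ℝ := fun n u => ((n : ℝ) + 1)⁻¹ * ∑ k ∈ Finset.range (n + 1), F k u
    with hA
  have hAS : ∀ n, IsSymmForm p (A n) := fun n =>
    isSymmForm_const_mul hp0 (isSymmForm_sum hp0 _ hFS) (by positivity)
  have hAC : ∀ n u, A n u ≤ C * refEnergy p u := by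
    intro n u
    rw [hA]
    refine (inv_mul_le_iff₀ (by positivity)).2 ?_
    simpa using Finset.sum_le_card_nsmul (Finset.range (n + 1)) _ _ fun k _ => hFC k u
  have hAδ : ∀ n, δ ≤ A n (Pi.single 0 1) := by
    intro n
    rw [hA]
    refine (le_inv_mul_iff₀ (by positivity)).2 ?_
    simpa using Finset.card_nsmul_le_sum (Finset.range (n + 1)) _ _ fun k _ => hFδ k
  have hlim : ∀ u, ∃ a, Filter.Tendsto (fun n => A n u) (Filter.hyperfilter ℕ) (nhds a) := by
    intro u
    obtain ⟨a, -, ha⟩ := (isCompact_Icc (a := (0 : ℝ)) (b := C * refEnergy p u)).ultrafilter_le_nhds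
      ((Filter.hyperfilter ℕ).map fun n => A n u) (by
        rw [Filter.le_principal_iff]
        exact Filter.Eventually.of_forall (f := (Filter.hyperfilter ℕ : Filter ℕ))
          fun n => ⟨(hAS n).nonneg u, hAC n u⟩)
    exact ⟨a, ha⟩
  choose A' hA' using hlim
  refine ⟨A', isSymmForm_of_tendsto hp0 hAS hA', ge_of_tendsto' (hA' _) hAδ,
    fun u => le_of_tendsto' (hA' u) fun n => hAC n u, fun u => le_renormTrace fun w hw => ?_⟩
  have h1 : Filter.Tendsto (fun n => c * (A n u + ((n : ℝ) + 1)⁻¹ * (F (n + 1) u - F 0 u)))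
      (Filter.hyperfilter ℕ) (nhds (c * A' u)) := by
    have h0 : Filter.Tendsto (fun n : ℕ => ((n : ℝ) + 1)⁻¹ * (F (n + 1) u - F 0 u))
        Filter.atTop (nhds 0) := by
      have hz : Filter.Tendsto (fun n : ℕ => ((n : ℝ) + 1)⁻¹) Filter.atTop (nhds 0) := by
        simpa only [one_div] using tendsto_one_div_add_atTop_nhds_zero_nat (𝕜 := ℝ)
      refine bdd_le_mul_tendsto_zero' (C * refEnergy p u)
        (Filter.Eventually.of_forall fun n => ?_) hz |>.congr fun n => mul_comm _ _
      rw [abs_le]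
      have := hFC (n + 1) u
      have := hFC 0 u
      have := hF0 (n + 1) u
      have := hF0 0 u
      constructor <;> linarith
    simpa using ((hA' u).add (h0.mono_left Nat.hyperfilter_le_atTop)).const_mul c
  refine le_of_tendsto_of_tendsto' h1 (tendsto_finsetSum _ fun i _ => hA' (w i)) fun n => ?_
  calc c * (A n u + ((n : ℝ) + 1)⁻¹ * (F (n + 1) u - F 0 u))
      = ((n : ℝ) + 1)⁻¹ * ∑ k ∈ Finset.range (n + 1), c * F (k + 1) u := by
        have := Finset.sum_range_succ' (fun k => F k u) (n + 1)
        rw [Finset.sum_range_succ] at this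
        rw [hA, ← Finset.mul_sum, eq_sub_of_add_eq this.symm]
        ring
    _ ≤ ((n : ℝ) + 1)⁻¹ * ∑ k ∈ Finset.range (n + 1), ∑ i, F k (w i) := by
        gcongr with k
        rw [← hFΛ]
        exact renormTrace_le (hF0 k) hw
    _ = ∑ i, A n (w i) := by
        rw [Finset.sum_comm, Finset.mul_sum]

/-- There is a nondegenerate symmetric eigenform: starting from `A` with `Λ(A) ≥ c A`, the sequence
`c⁻ⁿ Λⁿ(A)` increases to it. -/
theorem exists_eigenform {p : ℝ} (hp : 1 ≤ p) :
    ∃ c : ℝ, 0 < c ∧ ∃ G, IsSymmForm p G ∧ 0 < conductance G ∧ ∀ u, renormTrace G u = c * G u := by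
  have hp0 : 0 < p := by linarith
  obtain ⟨c, hc, C, hC, δ, hδ, hbd⟩ := exists_iterate_refEnergy_bounds hp
  obtain ⟨A, hA, hAδ, hAC, hAΛ⟩ := exists_isSymmForm_mul_le_renormTrace hp hc
    (fun n => (hbd n).1) fun n => (hbd n).2
  have hS := isSymmForm_iterate_renormTrace hp hA
  set G : ℕ → (Fin 3 → ℝ) → ℝ := fun n u => (c ^ n)⁻¹ * renormTrace^[n] A u with hG
  have hGS : ∀ n, IsSymmForm p (G n) := fun n => isSymmForm_const_mul hp0 (hS n) (by positivity)
  have hGΛ : ∀ n u, renormTrace (G n) u = c * G (n + 1) u := by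
    intro n u
    rw [hG]
    simp only [Function.iterate_succ_apply']
    rw [renormTrace_const_mul (by positivity) (hS n).nonneg, pow_succ]
    field_simp
  have hmono : Monotone G := by
    refine monotone_nat_of_le_succ fun n u => ?_
    have := iterate_renormTrace_le_mul (inv_pos.2 hc) hA.nonneg
      (fun u => (le_inv_mul_iff₀ hc).2 (hAΛ u)) n u
    rw [← Function.iterate_succ_apply] at this
    rw [hG]
    simp only [pow_succ, mul_inv, mul_assoc]
    gcongr
  have hbdd : ∀ u, BddAbove (Set.range fun n => G n u) := by
    refine fun u => ⟨C * (C * refEnergy p u), Set.forall_mem_range.2 fun n => ?_⟩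
    rw [hG]
    refine (inv_mul_le_iff₀ (by positivity)).2 ?_
    refine (iterate_renormTrace_le_mul hC hA.nonneg hAC n u).trans ?_
    have := mul_le_mul_of_nonneg_left ((hbd n).2 u) hC.le
    linarith
  have hG0 : 0 < conductance (G 0) := by
    have : conductance (G 0) = conductance A := by simp [hG, conductance]
    rw [this]
    exact hδ.trans_le hAδ
  have hlim : ∀ u, Filter.Tendsto (fun n => G n u) Filter.atTop (nhds (⨆ n, G n u)) := fun u =>
    tendsto_atTop_ciSup (fun m n hmn => hmono hmn u) (hbdd u)
  have hle : ∀ n u, G n u ≤ ⨆ n, G n u := fun n u => le_ciSup (hbdd u) n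
  refine ⟨c, hc, fun u => ⨆ n, G n u, isSymmForm_of_tendsto hp0 hGS hlim, hG0.trans_le (hle 0 _),
    fun u => le_antisymm ?_ ?_⟩
  · refine renormTrace_le_of_monotone hp hGS hmono hG0 hlim fun n => ?_
    rw [hGΛ]
    exact mul_le_mul_of_nonneg_left (hle _ u) hc.le
  · refine le_of_tendsto' (((hlim u).comp (Filter.tendsto_add_atTop_nat 1)).const_mul c) fun n => ?_
    rw [Function.comp_apply, ← hGΛ]
    simpa using renormTrace_le_mul one_pos (hGS n).nonneg (fun u => by simpa using hle n u) u

/-! ### Uniqueness of the eigenvalue -/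

theorem iterate_renormTrace_of_eigenform {c : ℝ} (hc : 0 < c) {E : (Fin 3 → ℝ) → ℝ}
    (h : ∀ u, 0 ≤ E u) (hE : ∀ u, renormTrace E u = c * E u) (n : ℕ) (u : Fin 3 → ℝ) :
    renormTrace^[n] E u = c ^ n * E u := by
  induction n generalizing u with
  | zero => simp
  | succ n ih =>
    rw [Function.iterate_succ_apply', funext ih, renormTrace_const_mul (by positivity) h, hE]
    ring

/-- Eigenvalues of comparable forms are ordered, since the renormalization operator is monotone. -/
theorem eigenvalue_le_of_le_mul {c c' C : ℝ} (hc : 0 < c) (hc' : 0 < c') (hC : 0 < C)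
    {E E' : (Fin 3 → ℝ) → ℝ} (h : ∀ u, 0 ≤ E u) (h' : ∀ u, 0 ≤ E' u)
    (hE : ∀ u, renormTrace E u = c * E u) (hE' : ∀ u, renormTrace E' u = c' * E' u)
    (hle : ∀ u, E u ≤ C * E' u) {u : Fin 3 → ℝ} (hu : 0 < E u) : c ≤ c' := by
  by_contra hlt
  rw [not_le] at hlt
  obtain ⟨n, hn⟩ := pow_unbounded_of_one_lt (C * E' u / E u) ((one_lt_div hc').2 hlt)
  have := iterate_renormTrace_le_mul hC h hle n u
  rw [iterate_renormTrace_of_eigenform hc h hE, iterate_renormTrace_of_eigenform hc' h' hE'] at this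
  rw [div_pow, div_lt_div_iff₀ hu (by positivity)] at hn
  linarith

/-! ### Resistance forms on a set of three points -/

section Transfer

variable {p : ℝ} {X : Type*} (e : Fin 3 ≃ X)

/-- The lower bound of a symmetric form by its conductance yields the completeness (RF2) and the
finiteness of the resistances (RF4). -/
theorem IsSymmForm.isFinitePResistanceForm (hp : 1 ≤ p) {G : (Fin 3 → ℝ) → ℝ}
    (h : IsSymmForm p G) (h0 : 0 < conductance G) :
    IsFinitePResistanceForm p fun u : X → ℝ => G fun i => u (e i) := by
  classical
  have hp0 : 0 < p := by linarith
  have hbd : ∀ (u : X → ℝ) (x y : X),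
      |u x - u y| ^ p ≤ 2 ^ p / conductance G * G fun i => u (e i) := by
    intro u x y
    rw [div_mul_eq_mul_div, le_div_iff₀' h0]
    simpa using h.abs_sub_rpow_le hp (fun i => u (e i)) (e.symm x) (e.symm y)
  refine ⟨fun u _ => h.nonneg _, ?_, ?_, ?_, ?_, ?_, ?_⟩
  · refine ⟨Seminorm.of (fun u => (G fun i => u.1 (e i)) ^ (1 / p)) (fun u v => ?_)
      fun a u => ?_, fun u => rfl⟩
    · exact h.rpow_add_le hp (fun i => u.1 (e i)) fun i => v.1 (e i)
    · exact h.rpow_smul hp0 a fun i => u.1 (e i)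
  · refine fun u => ⟨fun hu => ⟨u (e 0), funext fun x => ?_⟩, ?_⟩
    · have := hbd u x (e 0)
      rw [hu.2, mul_zero] at this
      have h1 := le_antisymm this (by positivity)
      rwa [Real.rpow_eq_zero (abs_nonneg _) hp0.ne', abs_eq_zero, sub_eq_zero] at h1
    · rintro ⟨c, rfl⟩
      exact ⟨trivial, h.const c⟩
  · intro u _ hu
    -- Normalized to vanish at one point, the functions converge pointwise.
    have hcauchy : ∀ x, CauchySeq fun n => u n x - u n (e 0) := by
      intro x
      set B : ℝ := (2 ^ p / conductance G) ^ (1 / p) with hB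
      have hB0 : 0 < B := by positivity
      rw [Metric.cauchySeq_iff]
      intro ε hε
      obtain ⟨N, hN⟩ := hu (ε / B) (by positivity)
      refine ⟨N, fun m hm n hn => ?_⟩
      have h1 := Real.rpow_le_rpow (by positivity) (hbd (u m - u n) x (e 0))
        (one_div_pos.2 hp0).le
      rw [one_div, Real.rpow_rpow_inv (abs_nonneg _) hp0.ne', ← one_div,
        Real.mul_rpow (by positivity) (h.nonneg _)] at h1
      have h2 := hN m n hm hn
      rw [lt_div_iff₀' hB0] at h2
      rw [Real.dist_eq]
      refine lt_of_eq_of_lt ?_ (h1.trans_lt h2)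
      simp only [Pi.sub_apply]
      congr 1
      ring
    choose v hv using fun x => cauchySeq_tendsto_of_complete (hcauchy x)
    refine ⟨v, trivial, ?_⟩
    have h1 : Filter.Tendsto (fun n => fun i => u n (e i) - u n (e 0) - v (e i)) Filter.atTop
        (nhds fun _ => (0 : ℝ)) := tendsto_pi_nhds.2 fun i => by
      simpa using (hv (e i)).sub_const (v (e i))
    have h2 := (((h.continuous hp).tendsto _).comp h1).rpow_const (p := 1 / p)
      (Or.inr (by positivity))
    rw [h.const, Real.zero_rpow (by positivity)] at h2
    refine h2.congr fun n => ?_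
    rw [Function.comp_apply]
    congr 1
    rw [← h.add_const hp (fun i => (u n - v) (e i)) (-u n (e 0))]
    congr 1
    ext i
    simp only [Pi.sub_apply]
    ring
  · intro x y hxy
    exact ⟨Pi.single x 1, trivial, by simp [hxy.symm]⟩
  · rintro x y
    refine ⟨2 ^ p / conductance G, ?_⟩
    rintro _ ⟨u, -, -, rfl⟩
    exact div_le_of_le_mul₀ (h.nonneg _) (by positivity) (hbd u x y)
  · intro q r hq hqp hpr m n hm hn T hT hT0 u _
    exact ⟨fun _ => trivial, (h.contr.comp e) q r hq hqp hpr m n hm hn T hT hT0 u⟩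

theorem IsFinitePResistanceForm.isPreForm (hp : 0 < p) {E : (X → ℝ) → ℝ}
    (h : IsFinitePResistanceForm p E) :
    IsPreForm p fun u : Fin 3 → ℝ => E fun x => u (e.symm x) := by
  refine ⟨fun u => h.nonneg _ trivial, fun a u => ?_,
    fun c => ((h.rf1_ker _).2 ⟨c, rfl⟩).2, ?_⟩
  · obtain ⟨N, hN⟩ := h.rf1_seminorm
    have h1 := map_smul_eq_mul N a ⟨fun x => u (e.symm x), trivial⟩
    rw [hN, hN, Real.norm_eq_abs] at h1
    have h0 := h.nonneg (fun x => u (e.symm x)) trivial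
    have h2 := congrArg (· ^ p) h1
    simp only [one_div] at h2
    rw [Real.rpow_inv_rpow (h.nonneg _ trivial) hp.ne',
      Real.mul_rpow (abs_nonneg _) (Real.rpow_nonneg h0 _), Real.rpow_inv_rpow h0 hp.ne'] at h2
    exact h2
  · refine GenContraction.comp (E := E) ?_ _
    intro q r hq hqp hpr m n hm hn T hT hT0 u
    exact (h.rf5 q r hq hqp hpr m n hm hn T hT hT0 u fun _ => trivial).2

/-- Finite resistances (RF4) make every resistance form on three points nondegenerate. -/
theorem IsFinitePResistanceForm.exists_refEnergy_le {E : (X → ℝ) → ℝ} (hp : 0 < p)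
    (h : IsFinitePResistanceForm p E) :
    ∃ C : ℝ, 0 < C ∧ ∀ u : Fin 3 → ℝ, refEnergy p u ≤ C * E fun x => u (e.symm x) := by
  have key : ∀ x y : X, ∃ B : ℝ, ∀ u : X → ℝ, |u x - u y| ^ p ≤ B * E u := by
    intro x y
    obtain ⟨B, hB⟩ := h.rf4 x y
    refine ⟨B, fun u => ?_⟩
    by_cases hu : ∃ c : ℝ, u = fun _ => c
    · rw [((h.rf1_ker u).2 hu).2]
      obtain ⟨c, rfl⟩ := hu
      simp [hp.ne']
    · have h0 : 0 < E u := (h.nonneg u trivial).lt_of_ne' fun h0 =>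
        hu ((h.rf1_ker u).1 ⟨trivial, h0⟩)
      exact (div_le_iff₀ h0).1 (hB ⟨u, trivial, hu, rfl⟩)
  choose B hB using key
  refine ⟨max 1 (B (e 0) (e 1) + B (e 1) (e 2) + B (e 2) (e 0)), by positivity, fun u => ?_⟩
  have h1 := hB (e 0) (e 1) fun x => u (e.symm x)
  have h2 := hB (e 1) (e 2) fun x => u (e.symm x)
  have h3 := hB (e 2) (e 0) fun x => u (e.symm x)
  simp only [Equiv.symm_apply_apply] at h1 h2 h3
  refine le_trans ?_ (mul_le_mul_of_nonneg_right (le_max_right _ _) (h.nonneg _ trivial))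
  rw [refEnergy]
  linarith

end Transfer

/-! ### Geometry of the gasket -/

namespace IsEquilateralTriangle

variable {q : Fin 3 → Plane}

theorem injective (hq : IsEquilateralTriangle q) : Function.Injective q := by
  obtain ⟨ℓ, hℓ, h⟩ := hq
  intro i j hij
  by_contra hne
  have := h i j hne
  rw [hij, dist_self] at this
  linarith

/-- The enumeration of the vertices. -/
def vertexEquiv (hq : IsEquilateralTriangle q) : Fin 3 ≃ sgV0 q :=
  Equiv.ofInjective q hq.injective

@[simp]
theorem coe_vertexEquiv (hq : IsEquilateralTriangle q) (i : Fin 3) :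
    (hq.vertexEquiv i : Plane) = q i := rfl

end IsEquilateralTriangle

/-- In barycentric coordinates, an equilateral triangle induces a multiple of the standard Euclidean
metric. -/
theorem norm_sum_smul_sq {q : Fin 3 → Plane} {ℓ : ℝ}
    (hq : ∀ i j : Fin 3, i ≠ j → dist (q i) (q j) = ℓ)
    {a : Fin 3 → ℝ} (ha : ∑ i, a i = 0) :
    ‖∑ i, a i • q i‖ ^ 2 = ℓ ^ 2 / 2 * ∑ i, a i ^ 2 := by
  have h1 : ‖q 1 - q 0‖ ^ 2 = ℓ ^ 2 := by rw [← dist_eq_norm, hq 1 0 (by decide)]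
  have h2 : ‖q 2 - q 0‖ ^ 2 = ℓ ^ 2 := by rw [← dist_eq_norm, hq 2 0 (by decide)]
  have h3 : ‖(q 1 - q 0) - (q 2 - q 0)‖ ^ 2 = ℓ ^ 2 := by
    rw [sub_sub_sub_cancel_right, ← dist_eq_norm, hq 1 2 (by decide)]
  rw [norm_sub_sq_real] at h3
  rw [Fin.sum_univ_three] at ha
  have ha0 : a 0 = -a 1 - a 2 := by linarith
  have e : ∑ i, a i • q i = a 1 • (q 1 - q 0) + a 2 • (q 2 - q 0) := by
    rw [Fin.sum_univ_three, ha0]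
    module
  rw [e, norm_add_sq_real, norm_smul, norm_smul, inner_smul_left, inner_smul_right,
    Fin.sum_univ_three, mul_pow, mul_pow, h1, h2, Real.norm_eq_abs, Real.norm_eq_abs, sq_abs,
    sq_abs, ha0, starRingEnd_apply, star_trivial]
  have h4 : inner ℝ (q 1 - q 0) (q 2 - q 0) = ℓ ^ 2 / 2 := by linarith
  rw [h4]
  ring

theorem sgMap_comm (q : Fin 3 → Plane) (i j : Fin 3) : sgMap q i (q j) = sgMap q j (q i) := by
  simp only [sgMap]
  module

/-- The points `f_i(q_j)` of `V₁` are the midpoints of `q_i` and `q_j`; they are distinct for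
distinct unordered pairs. -/
theorem sgMap_eq_sgMap {q : Fin 3 → Plane} (hq : IsEquilateralTriangle q) {i j k l : Fin 3}
    (h : sgMap q i (q j) = sgMap q k (q l)) : (i = k ∧ j = l) ∨ (i = l ∧ j = k) := by
  obtain ⟨ℓ, hℓ, hd⟩ := hq
  set a : Fin 3 → ℝ := fun m => ((if i = m then 1 else 0) + if j = m then 1 else 0) -
    ((if k = m then 1 else 0) + if l = m then 1 else 0) with ha
  have hsum : ∑ m, a m = 0 := by
    simp [ha, Finset.sum_sub_distrib, Finset.sum_add_distrib]
  have hvec : ∑ m, a m • q m = 0 := by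
    have : q i + q j = q k + q l := by
      have h2 := congrArg (fun x => (2 : ℝ) • x) h
      simp only [sgMap] at h2
      have e : ∀ x y : Plane, (2 : ℝ) • (x + (1 / 2 : ℝ) • (y - x)) = x + y := fun x y => by module
      rwa [e, e] at h2
    simp [ha, sub_smul, add_smul, ite_smul, Finset.sum_sub_distrib, Finset.sum_add_distrib, this]
  have hsq := norm_sum_smul_sq hd hsum
  rw [hvec, norm_zero, zero_pow two_ne_zero, zero_eq_mul, or_iff_right (by positivity),
    Finset.sum_eq_zero_iff_of_nonneg fun _ _ => sq_nonneg _] at hsq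
  have hm : ∀ m, ((if i = m then 1 else 0) + if j = m then 1 else 0 : ℕ) =
      (if k = m then 1 else 0) + if l = m then 1 else 0 := fun m => by
    have := sub_eq_zero.1 (pow_eq_zero_iff two_ne_zero |>.1 (hsq m (Finset.mem_univ m)))
    exact_mod_cast this
  clear h a ha hsum hvec hsq
  revert i j k l
  decide

/-- The gasket lies in the triangle spanned by its outer vertices. -/
theorem sierpinskiGasket_subset_triangle (q : Fin 3 → Plane) :
    sierpinskiGasket q ⊆ (fun s : Fin 3 → ℝ => ∑ i, s i • q i) '' stdSimplex ℝ (Fin 3) := by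
  set T := (fun s : Fin 3 → ℝ => ∑ i, s i • q i) '' stdSimplex ℝ (Fin 3)
  have hTc : IsCompact T := (isCompact_stdSimplex ℝ (Fin 3)).image (by fun_prop)
  have hTne : T.Nonempty := ⟨_, _, single_mem_stdSimplex ℝ 0, rfl⟩
  have hTf : ∀ i, ∀ t ∈ T, sgMap q i t ∈ T := by
    rintro i _ ⟨s, hs, rfl⟩
    refine ⟨(1 / 2 : ℝ) • Pi.single i 1 + (1 / 2 : ℝ) • s,
      convex_stdSimplex ℝ (Fin 3) (single_mem_stdSimplex ℝ i) hs (by norm_num) (by norm_num)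
        (by norm_num), ?_⟩
    simp only [Pi.add_apply, Pi.smul_apply, add_smul, smul_eq_mul, mul_smul, Finset.sum_add_distrib,
      ← Finset.smul_sum, sgMap]
    rw [show ∑ j, (Pi.single i (1 : ℝ) : Fin 3 → ℝ) j • q j = q i by
      simp [Pi.single_apply, ite_smul]]
    module
  obtain ⟨hne, hc, hK⟩ := isSelfSimilar_sierpinskiGasket q
  obtain ⟨x, hx, hmax⟩ := hc.exists_isMaxOn hne (Metric.continuous_infDist_pt T).continuousOn
  -- The maximal distance `d` from a point of `K` to `T` satisfies `d ≤ d / 2`.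
  have hx0 : Metric.infDist x T ≤ 0 := by
    have hx' := hx
    rw [hK] at hx'
    obtain ⟨i, y, hy, rfl⟩ := Set.mem_iUnion.1 hx'
    obtain ⟨t, ht, hyt⟩ := hTc.exists_infDist_eq_dist hTne y
    have h1 := Metric.infDist_le_dist_of_mem (x := sgMap q i y) (hTf i t ht)
    have h2 : dist (sgMap q i y) (sgMap q i t) = 1 / 2 * dist y t := by
      simp [sgMap, dist_smul₀]
    have h3 : Metric.infDist y T ≤ Metric.infDist (sgMap q i y) T := hmax hy
    linarith
  intro y hy
  have : Metric.infDist y T = 0 := le_antisymm ((hmax hy).trans hx0) Metric.infDist_nonneg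
  exact (hTc.isClosed.mem_iff_infDist_zero hTne).2 this

/-- Only vertices realize the diameter of the gasket, which is the side length of the triangle. -/
theorem mem_sgV0_of_dist_eq {q : Fin 3 → Plane} {ℓ : ℝ} (hℓ : 0 < ℓ)
    (hq : ∀ i j : Fin 3, i ≠ j → dist (q i) (q j) = ℓ) {x y : Plane} (hx : x ∈ sierpinskiGasket q)
    (hy : y ∈ sierpinskiGasket q) (hxy : dist x y = ℓ) : x ∈ sgV0 q := by
  obtain ⟨s, hs, rfl⟩ := sierpinskiGasket_subset_triangle q hx
  obtain ⟨t, ht, rfl⟩ := sierpinskiGasket_subset_triangle q hy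
  have h := norm_sum_smul_sq hq (a := fun i => s i - t i)
    (by rw [Finset.sum_sub_distrib, hs.2, ht.2, sub_self])
  simp only [sub_smul, Finset.sum_sub_distrib] at h
  rw [← dist_eq_norm, hxy] at h
  have h2 : ∑ i, (s i - t i) ^ 2 = 2 := by
    have : 0 < ℓ ^ 2 := by positivity
    have h' : ℓ ^ 2 * (∑ i, (s i - t i) ^ 2 - 2) = 0 := by linarith
    rcases mul_eq_zero.1 h' with h0 | h0 <;> linarith
  have hsq : ∀ r ∈ stdSimplex ℝ (Fin 3), ∀ i, 0 ≤ r i * (1 - r i) := fun r hr i =>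
    mul_nonneg (hr.1 i) (sub_nonneg.2 ((mem_Icc_of_mem_stdSimplex hr i).2))
  have hsum : ∑ i, s i * (1 - s i) ≤ 0 := by
    have h0 : 0 ≤ ∑ i, (t i * (1 - t i) + 2 * (s i * t i)) := Finset.sum_nonneg fun i _ =>
      add_nonneg (hsq t ht i) (mul_nonneg zero_le_two (mul_nonneg (hs.1 i) (ht.1 i)))
    have e : ∑ i, (s i - t i) ^ 2 = ∑ i, s i + ∑ i, t i - ∑ i, s i * (1 - s i)
        - ∑ i, (t i * (1 - t i) + 2 * (s i * t i)) := by
      rw [← Finset.sum_add_distrib, ← Finset.sum_sub_distrib, ← Finset.sum_sub_distrib]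
      exact Finset.sum_congr rfl fun i _ => by ring
    rw [hs.2, ht.2, h2] at e
    linarith
  have hzero := (Finset.sum_eq_zero_iff_of_nonneg fun i _ => hsq s hs i).1
    (le_antisymm hsum (Finset.sum_nonneg fun i _ => hsq s hs i))
  obtain ⟨i, hi⟩ : ∃ i, s i ≠ 0 := by
    by_contra! h0
    have := hs.2
    simp [h0] at this
  have hi1 : s i = 1 := by
    have := (mul_eq_zero.1 (hzero i (Finset.mem_univ i))).resolve_left hi
    linarith
  refine ⟨i, ?_⟩
  have hj : ∀ j, j ≠ i → s j = 0 := fun j hji => by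
    have h3 := hs.2
    rw [← Finset.add_sum_erase _ _ (Finset.mem_univ i), hi1, add_eq_left,
      Finset.sum_eq_zero_iff_of_nonneg fun j _ => hs.1 j] at h3
    exact h3 j (Finset.mem_erase.2 ⟨hji, Finset.mem_univ j⟩)
  simp only
  rw [Finset.sum_eq_single i (fun j _ hji => by rw [hj j hji, zero_smul]) (by simp), hi1, one_smul]

/-! ### Eigenforms on the gasket -/

/-- Under the enumeration of the vertices, the renormalization operator on forms on `V₀` becomes
`ρ * renormTrace`. -/
theorem formTrace_sgRenorm {q : Fin 3 → Plane} (hq : IsEquilateralTriangle q) {ρ : ℝ} (hρ : 0 < ρ)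
    {E : (sgV0 q → ℝ) → ℝ} (hE : ∀ u, 0 ≤ E u) (u : sgV0 q → ℝ) :
    formTrace (sgV0_subset_sgV1 q) (sgRenorm q ρ E) u =
      ρ * renormTrace (fun v => E fun x => v (hq.vertexEquiv.symm x))
        fun i => u (hq.vertexEquiv i) := by
  rw [← renormTrace_const_mul hρ fun _ => hE _, formTrace, renormTrace]
  congr 1
  ext t
  constructor
  · rintro ⟨v, rfl, rfl⟩
    refine ⟨fun i j => v ⟨sgMap q i (q j), sgMap_mem_sgV1 q i ⟨j, rfl⟩⟩,
      ⟨fun i j => ?_, fun i => ?_⟩, ?_⟩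
    · simp only [sgMap_comm q i j]
    · exact congrArg v (Subtype.ext (by simp [sgMap]))
    · refine Finset.sum_congr rfl fun i _ => ?_
      congr 2
      ext x
      obtain ⟨j, rfl⟩ := hq.vertexEquiv.surjective x
      simp
  · rintro ⟨w, hw, rfl⟩
    have hV1 : ∀ x : sgV1 q, ∃ i j, sgMap q i (q j) = x := by
      rintro ⟨x, hx⟩
      obtain ⟨i, _, ⟨j, rfl⟩, rfl⟩ := Set.mem_iUnion.1 hx
      exact ⟨i, j, rfl⟩
    choose I J hIJ using hV1
    have hv : ∀ i j, ∀ hx : sgMap q i (q j) ∈ sgV1 q, w (I ⟨_, hx⟩) (J ⟨_, hx⟩) = w i j := by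
      intro i j hx
      rcases sgMap_eq_sgMap hq (hIJ ⟨_, hx⟩) with ⟨h1, h2⟩ | ⟨h1, h2⟩
      · rw [h1, h2]
      · rw [h1, h2, hw.1]
    refine ⟨fun x => w (I x) (J x), ?_, ?_⟩
    · ext x
      obtain ⟨i, rfl⟩ := hq.vertexEquiv.surjective x
      refine Eq.trans ?_ ((hv i i (sgMap_mem_sgV1 q i ⟨i, rfl⟩)).trans (hw.2 i))
      have : Set.inclusion (sgV0_subset_sgV1 q) (hq.vertexEquiv i)
          = ⟨sgMap q i (q i), sgMap_mem_sgV1 q i ⟨i, rfl⟩⟩ := Subtype.ext (by simp [sgMap])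
      rw [Function.comp_apply, this]
    · refine Finset.sum_congr rfl fun i _ => ?_
      congr 2
      ext x
      obtain ⟨j, rfl⟩ := hq.vertexEquiv.surjective x
      rw [Equiv.symm_apply_apply]
      exact (hv i j _).symm

theorem IsSymmForm.isSGSymmetric {p : ℝ} {q : Fin 3 → Plane} (hq : IsEquilateralTriangle q)
    {G : (Fin 3 → ℝ) → ℝ} (hG : IsSymmForm p G) :
    IsSGSymmetric q fun u => G fun i => u (hq.vertexEquiv i) := by
  intro g
  obtain ⟨ℓ, hℓ, hd⟩ := id hq
  have hg : ∀ x : sgV0 q, (g ⟨x, sgV0_subset_sierpinskiGasket q x.2⟩ : Plane) ∈ sgV0 q := by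
    rintro ⟨_, i, rfl⟩
    obtain ⟨j, hj⟩ : ∃ j : Fin 3, i ≠ j := ⟨i + 1, by revert i; decide⟩
    refine mem_sgV0_of_dist_eq hℓ hd (Subtype.coe_prop _)
      (g ⟨q j, sgV0_subset_sierpinskiGasket q ⟨j, rfl⟩⟩).2 ?_
    rw [← Subtype.dist_eq, g.dist_eq, Subtype.dist_eq]
    exact hd i j hj
  refine ⟨hg, fun u => ?_⟩
  have hinj : Function.Injective fun x : sgV0 q => (⟨_, hg x⟩ : sgV0 q) := by
    intro x y hxy
    have h0 : (g ⟨x, sgV0_subset_sierpinskiGasket q x.2⟩ : Plane) =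
        g ⟨y, sgV0_subset_sierpinskiGasket q y.2⟩ :=
      congrArg (fun z : sgV0 q => (z : Plane)) hxy
    have h1 := g.injective (Subtype.ext h0)
    exact Subtype.ext (congrArg (fun z : sierpinskiGasket q => (z : Plane)) h1)
  have hσ : Function.Bijective fun i => hq.vertexEquiv.symm ⟨_, hg (hq.vertexEquiv i)⟩ :=
    Finite.injective_iff_bijective.1
      (hq.vertexEquiv.symm.injective.comp (hinj.comp hq.vertexEquiv.injective))
  refine Eq.trans ?_ (hG.symm (Equiv.ofBijective _ hσ) fun i => u (hq.vertexEquiv i))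
  simp

theorem mainTheorem4 (p : ℝ) (hp : 1 < p) (q : Fin 3 → Plane) (hq : IsEquilateralTriangle q) :
    (∃! ρ : ℝ, 0 < ρ ∧ ∃ E : (sgV0 q → ℝ) → ℝ, IsSGEigenform p q ρ E) ∧
    (∀ ρ : ℝ, (0 < ρ ∧ ∃ E : (sgV0 q → ℝ) → ℝ, IsSGEigenform p q ρ E) →
      ∃ E : (sgV0 q → ℝ) → ℝ, IsSGEigenform p q ρ E ∧ IsSGSymmetric q E) := by
  have hp0 : 0 < p := by linarith
  obtain ⟨c, hc, G, hG, hG0, hGc⟩ := exists_eigenform hp.le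
  have hE : IsSGEigenform p q c⁻¹ fun u => G fun i => u (hq.vertexEquiv i) := by
    refine ⟨hG.isFinitePResistanceForm _ hp.le hG0, funext fun u => ?_⟩
    rw [formTrace_sgRenorm hq (inv_pos.2 hc) fun _ => hG.nonneg _]
    simp only [Equiv.symm_apply_apply]
    rw [hGc, inv_mul_cancel_left₀ hc.ne']
  have hle : ∀ ρ ρ' : ℝ, 0 < ρ → 0 < ρ' → (∃ E, IsSGEigenform p q ρ E) →
      (∃ E, IsSGEigenform p q ρ' E) → ρ' ≤ ρ := by
    rintro ρ ρ' hρ hρ' ⟨E, hE, hEρ⟩ ⟨E', hE', hEρ'⟩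
    have key : ∀ {ρ : ℝ} {E : (sgV0 q → ℝ) → ℝ}, 0 < ρ → IsFinitePResistanceForm p E →
        formTrace (sgV0_subset_sgV1 q) (sgRenorm q ρ E) = E → ∀ u,
        renormTrace (fun v => E fun x => v (hq.vertexEquiv.symm x)) u
          = ρ⁻¹ * E fun x => u (hq.vertexEquiv.symm x) := by
      intro ρ E hρ hE hEρ u
      have := congrFun hEρ fun x => u (hq.vertexEquiv.symm x)
      rw [formTrace_sgRenorm hq hρ fun _ => hE.nonneg _ trivial] at this
      simp only [Equiv.symm_apply_apply] at this
      rw [← this, inv_mul_cancel_left₀ hρ.ne']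
    have hF := hE.isPreForm hq.vertexEquiv hp0
    have hF' := hE'.isPreForm hq.vertexEquiv hp0
    obtain ⟨B, hB, hBE⟩ := hE.exists_refEnergy_le hq.vertexEquiv hp0
    obtain ⟨B', hB', hBE'⟩ := hE'.exists_refEnergy_le hq.vertexEquiv hp0
    obtain ⟨M, hM, h1, h2⟩ : ∃ M : ℝ, 0 < M ∧
        (E fun x => (Pi.single 1 1 : Fin 3 → ℝ) (hq.vertexEquiv.symm x)) ≤ M ∧
        (E fun x => (Pi.single 2 1 : Fin 3 → ℝ) (hq.vertexEquiv.symm x)) ≤ M :=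
      ⟨max 1 (max _ _), by positivity, (le_max_left _ _).trans (le_max_right _ _),
        (le_max_right _ _).trans (le_max_right _ _)⟩
    have hEM := hF.le_refEnergy hp.le h1 h2
    refine (inv_le_inv₀ hρ hρ').1 (eigenvalue_le_of_le_mul (inv_pos.2 hρ) (inv_pos.2 hρ')
      (C := 2 ^ p * M * B') (by positivity) hF.nonneg hF'.nonneg (key hρ hE hEρ)
      (key hρ' hE' hEρ') (fun u => ?_) (u := Pi.single 0 1) ?_)
    · rw [mul_assoc _ B']
      exact (hEM u).trans (mul_le_mul_of_nonneg_left (hBE' u) (by positivity))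
    · have h3 := hBE (Pi.single 0 1)
      have h4 : refEnergy p (Pi.single 0 1) = 2 := conductance_refEnergy hp0
      rw [h4] at h3
      exact pos_of_mul_pos_right (two_pos.trans_le h3) hB.le
  have huniq : ∀ ρ : ℝ, (0 < ρ ∧ ∃ E, IsSGEigenform p q ρ E) → ρ = c⁻¹ := fun ρ hρ =>
    le_antisymm (hle _ _ (inv_pos.2 hc) hρ.1 ⟨_, hE⟩ hρ.2)
      (hle _ _ hρ.1 (inv_pos.2 hc) hρ.2 ⟨_, hE⟩)
  refine ⟨⟨c⁻¹, ⟨inv_pos.2 hc, _, hE⟩, huniq⟩, fun ρ hρ => ⟨_, ?_, hG.isSGSymmetric hq⟩⟩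
  rw [huniq ρ hρ]
  exact hE

end
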